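/- Let $\Bbbk$ be a commutative ring and let $r\ge 0$. The degenerate affine Hecke algebra $\mathrm{AH}_r$ is the $\Bbbk$-algebra with generators $x_1,\dots,x_r$ and $s_1,\dots,s_{r-1}$, where the $x_i$ commute with each other, the $s_i$ satisfy the Coxeter relations of the basic transpositions of the symmetric group $S_r$, and $s_ix_i=x_{i+1}s_i+1$, $x_is_i=s_ix_{i+1}+1$, and $x_is_j=s_jx_i$ for $i\ne j,j+1$. Thus there are algebra maps $\Bbbk S_r\to\mathrm{AH}_r$ and $\mathrm{P}_r=\Bbbk[x_1,\dots,x_r]\to\mathrm{AH}_r$. Let $\mathrm{P}^{(r)}=\mathrm{P}_r^{S_r}$ be the algebra of symmetric polynomials. For a composition $\lambda=(\lambda_1,\dots,\lambda_n)$ of $r$ (with $n\ge 0$ and parts $\lambda_i\ge 0$ summing to $r$), let $S_\lambda=S_{\lambda_1}\times\cdots\times S_{\lambda_n}\le S_r$ and let $M(\lambda)=\Bbbk_\lambda\otimes_{\Bbbk S_\lambda}\Bbbk S_r$ be the right permutation module induced from the trivial right $\Bbbk S_\lambda$-module $\Bbbk_\lambda$, with generator $m_\lambda=1\otimes 1$.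 The degenerate affine Schur category $\mathbf{ASchur}$ is the $\Bbbk$-linear category whose objects are all compositions, whose morphisms $\mu\to\lambda$ are the right $\mathrm{AH}_r$-module homomorphisms $M(\mu)\otimes_{\Bbbk S_r}\mathrm{AH}_r\to M(\lambda)\otimes_{\Bbbk S_r}\mathrm{AH}_r$ if $|\mu|=|\lambda|=r$, and only $0$ if $|\mu|\ne|\lambda|$, composed in the obvious way. **Lemma.** For all $n,r\ge 0$, every composition $\lambda$ of $r$ with $n$ parts and every $f\in\mathrm{P}^{(r)}$, there is a unique $f1_\lambda\in\operatorname{End}_{\mathbf{ASchur}}(\lambda)$ such that $f1_\lambda(m_\lambda\otimes 1)=m_\lambda\otimes f$. Moreover, the map $$\mathrm{P}^{(r)}\to Z\big(\operatorname{End}_{\mathbf{ASchur}}(\lambda)\big),\qquad f\mapsto f1_\lambda,$$ is an isomorphism of $\Bbbk$-algebras onto the center of $\operatorname{End}_{\mathbf{ASchur}}(\lambda)$. -/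

import Mathlib

open scoped TensorProduct

noncomputable section

namespace AffSchur

universe u

section SymmetricGroupPresentation

/-! ### Homomorphisms out of the symmetric group

A family of elements of a monoid satisfying the Coxeter relations of the basic transpositions
determines a monoid homomorphism from the symmetric group.  This is what turns the group algebra
of the symmetric group into a source of an algebra map to the degenerate affine Hecke algebra. -/

/-- The product `t j * t (j+1) * ⋯ * t (m-1)`. -/
def cycProd {M : Type*} [Monoid M] (t : ℕ → M) : ℕ → ℕ → M
  | 0, _ => 1
  | m + 1, j => if j ≤ m then cycProd t m j * t m else 1

/-- The Coxeter relations of type `A` among `t 0, …, t (N-1)`. -/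
structure CoxRel {M : Type*} [Monoid M] (t : ℕ → M) (N : ℕ) : Prop where
  sq : ∀ i, i < N → t i * t i = 1
  comm : ∀ i j, i + 1 < j → j < N → t i * t j = t j * t i
  braid : ∀ i, i + 1 < N → t i * t (i + 1) * t i = t (i + 1) * t i * t (i + 1)

variable {M : Type*} [Monoid M] {t : ℕ → M} {N : ℕ}

lemma cycProd_succ {m j : ℕ} (h : j ≤ m) : cycProd t (m + 1) j = cycProd t m j * t m := by
  simp [cycProd, h]

lemma cycProd_self (m : ℕ) : cycProd t m m = 1 := by
  cases m <;> simp [cycProd]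

lemma cycProd_head {m j : ℕ} (h : j < m) : cycProd t m j = t j * cycProd t m (j + 1) := by
  induction m with
  | zero => omega
  | succ m ih =>
    rw [cycProd_succ (by omega)]
    rcases Nat.lt_or_ge j m with h' | h'
    · rw [ih h', cycProd_succ (by omega), mul_assoc]
    · obtain rfl : j = m := by omega
      rw [cycProd_self, cycProd_self, one_mul, mul_one]

lemma CoxRel.cyc_comm (ht : CoxRel t N) {m i j : ℕ} (hm : m ≤ N) (h : i + 1 < j) (hj : j ≤ m) :
    t i * cycProd t m j = cycProd t m j * t i := by
  induction m with
  | zero => omega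
  | succ m ih =>
    rcases Nat.lt_or_ge m j with h' | h'
    · obtain rfl : j = m + 1 := by omega
      simp [cycProd_self]
    · rw [cycProd_succ h', ← mul_assoc, ih (by omega) h', mul_assoc, mul_assoc,
        ht.comm i m (by omega) (by omega)]

lemma CoxRel.cyc_shift (ht : CoxRel t N) {m i j : ℕ} (hm : m ≤ N) (h : j ≤ i) (hi : i + 1 < m) :
    t (i + 1) * cycProd t m j = cycProd t m j * t i := by
  induction m with
  | zero => omega
  | succ m ih =>
    rw [cycProd_succ (by omega)]
    rcases Nat.lt_or_ge (i + 1) m with h' | h'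
    · rw [← mul_assoc, ih (by omega) h', mul_assoc, mul_assoc, ht.comm i m h' (by omega)]
    · obtain rfl : m = i + 1 := by omega
      have hc : t (i + 1) * cycProd t i j = cycProd t i j * t (i + 1) := by
        clear ih hi h'
        have key : ∀ p, p ≤ i → t (i + 1) * cycProd t p j = cycProd t p j * t (i + 1) := by
          intro p
          induction p with
          | zero => intro _; simp [cycProd]
          | succ p ihp =>
            intro hp
            by_cases hjp : j ≤ p
            · rw [cycProd_succ hjp, ← mul_assoc, ihp (by omega), mul_assoc, mul_assoc,
                ht.comm p (i + 1) (by omega) (by omega)]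
            · simp [cycProd, hjp]
        exact key i le_rfl
      rw [cycProd_succ h]
      calc t (i + 1) * (cycProd t i j * t i * t (i + 1))
          = (t (i + 1) * cycProd t i j) * (t i * t (i + 1)) := by simp only [mul_assoc]
        _ = cycProd t i j * (t (i + 1) * t i * t (i + 1)) := by rw [hc]; simp only [mul_assoc]
        _ = cycProd t i j * (t i * t (i + 1) * t i) := by rw [ht.braid i (by omega)]
        _ = _ := by simp only [mul_assoc]

/-- The transposition `(i  i+1)` of the natural numbers. -/
def natSwap (i : ℕ) : Equiv.Perm ℕ := Equiv.swap i (i + 1)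

lemma natSwap_coxRel (N : ℕ) : CoxRel natSwap N where
  sq i _ := Equiv.swap_mul_self _ _
  comm i j h _ := by
    ext x
    simp only [natSwap, Equiv.Perm.mul_apply, Equiv.swap_apply_def]
    split_ifs <;> omega
  braid i _ := by
    ext x
    simp only [natSwap, Equiv.Perm.mul_apply, Equiv.swap_apply_def]
    split_ifs <;> omega

lemma natSwap_inv (i : ℕ) : (natSwap i)⁻¹ = natSwap i := Equiv.swap_inv _ _

lemma cycProd_natSwap_apply {m j : ℕ} (h : j ≤ m) : cycProd natSwap m j m = j := by
  induction m with
  | zero => simp [cycProd]; omega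
  | succ m ih =>
    rcases Nat.lt_or_ge m j with h' | h'
    · obtain rfl : j = m + 1 := by omega
      simp [cycProd_self]
    · rw [cycProd_succ h', Equiv.Perm.mul_apply]
      simp [natSwap, ih h']

lemma cycProd_natSwap_fix {m j x : ℕ} (h : m < x) : cycProd natSwap m j x = x := by
  induction m with
  | zero => simp [cycProd]
  | succ m ih =>
    by_cases hj : j ≤ m
    · rw [cycProd_succ hj, Equiv.Perm.mul_apply]
      have : natSwap m x = x := Equiv.swap_apply_of_ne_of_ne (by omega) (by omega)
      rw [this, ih (by omega)]
    · simp [cycProd, hj]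

/-- The value on a permutation `w` of `{0, …, m-1}` of the homomorphism sending `(i  i+1)` to
`t i`, computed from the factorization `w = (s_j s_{j+1} ⋯ s_{m-2}) w'` with `j = w (m-1)` and
`w'` fixing `m-1`. -/
def permVal {M : Type*} [Monoid M] (t : ℕ → M) : ℕ → Equiv.Perm ℕ → M
  | 0, _ => 1
  | m + 1, w => cycProd t m (w m) * permVal t m ((cycProd natSwap m (w m))⁻¹ * w)

lemma permVal_one (m : ℕ) : permVal t m 1 = 1 := by
  induction m with
  | zero => rfl
  | succ m ih => simp [permVal, cycProd_self, ih]

lemma CoxRel.permVal_mul {N : ℕ} (ht : CoxRel t N) :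
    ∀ (m : ℕ), m ≤ N + 1 → ∀ (w : Equiv.Perm ℕ), (∀ x, m ≤ x → w x = x) → ∀ i, i + 1 < m →
      permVal t m (natSwap i * w) = t i * permVal t m w := by
  intro m
  induction m with
  | zero => intro _ _ _ i hi; omega
  | succ m ih =>
    intro hm w hw i hi
    have hs := natSwap_coxRel m
    have hwm : w m ≤ m := by
      by_contra hlt
      have h1 := hw (w m) (by omega)
      have := w.injective h1
      omega
    obtain ⟨j, hj⟩ : ∃ j, j = w m := ⟨_, rfl⟩
    rw [← hj] at hwm
    have hfix : ∀ x, m ≤ x → ((cycProd natSwap m j)⁻¹ * w) x = x := by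
      intro x hx
      rw [Equiv.Perm.mul_apply, Equiv.Perm.inv_eq_iff_eq]
      rcases Nat.eq_or_lt_of_le hx with rfl | hx
      · rw [← hj, cycProd_natSwap_apply hwm]
      · rw [hw x (by omega), cycProd_natSwap_fix hx]
    simp only [permVal, Equiv.Perm.mul_apply, ← hj]
    rcases lt_trichotomy i j with hij | rfl | hij
    · rcases Nat.eq_or_lt_of_le (show i + 1 ≤ j from hij) with rfl | hij'
      · have e1 : natSwap i (i + 1) = i := by simp [natSwap]
        rw [e1, cycProd_head (t := t) (show i < m by omega), mul_assoc]
        congr 3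
        rw [cycProd_head (t := natSwap) (show i < m by omega), mul_inv_rev, mul_assoc,
          inv_mul_cancel_left]
      · have e1 : natSwap i j = j := Equiv.swap_apply_of_ne_of_ne (by omega) (by omega)
        rw [e1]
        have e2 : (cycProd natSwap m j)⁻¹ * (natSwap i * w)
            = natSwap i * ((cycProd natSwap m j)⁻¹ * w) := by
          rw [inv_mul_eq_iff_eq_mul, ← mul_assoc, ← hs.cyc_comm le_rfl hij' hwm, mul_assoc,
            mul_inv_cancel_left]
        rw [e2, ih (by omega) _ hfix i (by omega), ← mul_assoc, ← mul_assoc,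
          ht.cyc_comm (by omega) hij' hwm]
    · have e1 : natSwap i i = i + 1 := by simp [natSwap]
      have e2 : (cycProd natSwap m i)⁻¹ * w = (cycProd natSwap m (i + 1))⁻¹ * (natSwap i * w) := by
        rw [cycProd_head (t := natSwap) (show i < m by omega), mul_inv_rev, natSwap_inv, mul_assoc]
      rw [e1, e2, cycProd_head (t := t) (show i < m by omega), ← mul_assoc (t i), ← mul_assoc (t i),
        ht.sq i (by omega), one_mul]
    · have e1 : natSwap i j = j := Equiv.swap_apply_of_ne_of_ne (by omega) (by omega)
      rw [e1]
      obtain ⟨i, rfl⟩ : ∃ i', i = i' + 1 := ⟨i - 1, by omega⟩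
      have e2 : (cycProd natSwap m j)⁻¹ * (natSwap (i + 1) * w)
          = natSwap i * ((cycProd natSwap m j)⁻¹ * w) := by
        rw [inv_mul_eq_iff_eq_mul, ← mul_assoc, ← hs.cyc_shift le_rfl (by omega) (by omega),
          mul_assoc, mul_inv_cancel_left]
      rw [e2, ih (by omega) _ hfix i (by omega), ← mul_assoc, ← mul_assoc,
        ht.cyc_shift (by omega) (by omega) (by omega)]

/-- The basic transposition `(i  i+1)` of the symmetric group (indices starting at `0`). -/
def basicSwap {r : ℕ} (i : ℕ) (hi : i + 1 < r) : Equiv.Perm (Fin r) :=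
  Equiv.swap ⟨i, by omega⟩ ⟨i + 1, hi⟩

theorem exists_permHom (r : ℕ) (t : ℕ → M) (ht : CoxRel t (r - 1)) :
    ∃ φ : Equiv.Perm (Fin r) →* M, ∀ i (hi : i + 1 < r), φ (basicSwap i hi) = t i := by
  cases r with
  | zero => exact ⟨1, fun i hi => by omega⟩
  | succ n =>
    let E : Equiv.Perm (Fin (n + 1)) →* Equiv.Perm ℕ :=
      Equiv.Perm.extendDomainHom (Fin.equivSubtype (n := n + 1))
    have hE : ∀ (w : Equiv.Perm (Fin (n + 1))) (x : ℕ), n + 1 ≤ x → E w x = x := fun w x hx =>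
      Equiv.Perm.extendDomain_apply_not_subtype _ _ (by omega)
    have hEs : ∀ (i : Fin n), E (Equiv.swap i.castSucc i.succ) = natSwap i := by
      intro i
      ext x
      by_cases hx : x < n + 1
      · have h1 : E (Equiv.swap i.castSucc i.succ) x
            = (Equiv.swap i.castSucc i.succ ⟨x, hx⟩ : Fin (n + 1)) :=
          Equiv.Perm.extendDomain_apply_subtype _ (Fin.equivSubtype (n := n + 1)) hx
        rw [h1]
        simp only [natSwap, Equiv.swap_apply_def, Fin.ext_iff, Fin.val_castSucc, Fin.val_succ]
        split_ifs <;> simp_all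
      · rw [hE _ _ (by omega)]
        exact (Equiv.swap_apply_of_ne_of_ne (by omega) (by omega)).symm
    have hstep : ∀ (i : Fin n) (w : Equiv.Perm (Fin (n + 1))),
        permVal t (n + 1) (E (Equiv.swap i.castSucc i.succ * w))
          = t i * permVal t (n + 1) (E w) := by
      intro i w
      rw [map_mul, hEs]
      exact ht.permVal_mul (n + 1) (by omega) _ (hE w) i (by omega)
    have hone : permVal t (n + 1) (E 1) = 1 := by rw [map_one, permVal_one]
    refine ⟨{ toFun := fun w => permVal t (n + 1) (E w), map_one' := hone, map_mul' := ?_ }, ?_⟩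
    · intro a b
      have ha : a ∈ Submonoid.closure
          (Set.range fun i : Fin n => Equiv.swap i.castSucc i.succ) := by
        rw [Equiv.Perm.mclosure_swap_castSucc_succ]; trivial
      have key : ∀ b, permVal t (n + 1) (E (a * b))
          = permVal t (n + 1) (E a) * permVal t (n + 1) (E b) := by
        induction ha using Submonoid.closure_induction_left with
        | one => intro b; rw [one_mul, hone, one_mul]
        | mul_left x hx y hy ih =>
          obtain ⟨i, rfl⟩ := hx
          intro b
          simp only
          rw [mul_assoc, hstep, ih, hstep, mul_assoc]
      exact key b
    · intro i hi
      have := hstep ⟨i, by omega⟩ 1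
      rw [mul_one, hone, mul_one] at this
      exact this

end SymmetricGroupPresentation

section InducedModules

/-! ### Induction of right modules

A right module over a ring `S` is a module over `Sᵐᵒᵖ`; `v · s` is `MulOpposite.op s • v`. -/

variable {k : Type u} [CommRing k] {R S : Type u} [Ring R] [Algebra k R] [Ring S] [Algebra k S]
variable (φ : R →ₐ[k] S) (V : Type u) [AddCommGroup V] [Module k V] [Module Rᵐᵒᵖ V]

/-- The relations `(v · a) ⊗ s = v ⊗ φ(a) s`. -/
def indRel : Submodule k (V ⊗[k] S) :=
  Submodule.span k
    {z | ∃ (v : V) (a : R) (s : S), z = (MulOpposite.op a • v) ⊗ₜ[k] s - v ⊗ₜ[k] (φ a * s)}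

/-- The induced right `S`-module `V ⊗_R S`, where `V` is a right `R`-module and `S` is a left
`R`-module through `φ : R → S`. -/
def Ind : Type u := (V ⊗[k] S) ⧸ indRel φ V

instance : AddCommGroup (Ind φ V) := inferInstanceAs (AddCommGroup ((V ⊗[k] S) ⧸ indRel φ V))

instance : Module k (Ind φ V) := inferInstanceAs (Module k ((V ⊗[k] S) ⧸ indRel φ V))

/-- The quotient map `V ⊗_k S → V ⊗_R S`. -/
def indMk : V ⊗[k] S →ₗ[k] Ind φ V := (indRel φ V).mkQ

variable {V} in
/-- The pure tensor `v ⊗ s` in `V ⊗_R S`. -/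
def indTmul (v : V) (s : S) : Ind φ V := indMk φ V (v ⊗ₜ[k] s)

variable {V} in
lemma indTmul_balanced (v : V) (a : R) (s : S) :
    indTmul φ (MulOpposite.op a • v) s = indTmul φ v (φ a * s) := by
  rw [← sub_eq_zero, indTmul, indTmul, ← map_sub]
  exact (Submodule.Quotient.mk_eq_zero _).2 (Submodule.subset_span ⟨v, a, s, rfl⟩)

variable {V} in
lemma ind_hom_ext {W : Type*} [AddCommGroup W] [Module k W] {f g : Ind φ V →ₗ[k] W}
    (h : ∀ v s, f (indTmul φ v s) = g (indTmul φ v s)) : f = g := by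
  apply Submodule.linearMap_qext
  apply TensorProduct.ext'
  exact h

/-- Right multiplication by `s` on `V ⊗_R S`. -/
def indMulRight (s : S) : Module.End k (Ind φ V) :=
  Submodule.mapQ (indRel φ V) (indRel φ V) (LinearMap.lTensor V (LinearMap.mulRight k s)) (by
    rw [indRel, Submodule.span_le]
    rintro _ ⟨v, a, s', rfl⟩
    refine Submodule.subset_span ⟨v, a, s' * s, ?_⟩
    simp [mul_assoc])

variable {V} in
lemma indMulRight_tmul (v : V) (s s' : S) :
    indMulRight φ V s (indTmul φ v s') = indTmul φ v (s' * s) := rfl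

/-- The right action of `S` on `V ⊗_R S`. -/
def indAct : Sᵐᵒᵖ →+* Module.End k (Ind φ V) where
  toFun s := indMulRight φ V s.unop
  map_one' := by
    apply ind_hom_ext; intro v s; simp [indMulRight_tmul]
  map_mul' a b := by
    apply ind_hom_ext; intro v s; simp [indMulRight_tmul, mul_assoc]
  map_zero' := by
    apply ind_hom_ext; intro v s
    rw [MulOpposite.unop_zero, indMulRight_tmul, mul_zero, indTmul, TensorProduct.tmul_zero,
      map_zero, LinearMap.zero_apply]
  map_add' a b := by
    apply ind_hom_ext; intro v s
    rw [LinearMap.add_apply, MulOpposite.unop_add, indMulRight_tmul, indMulRight_tmul,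
      indMulRight_tmul, mul_add, indTmul, TensorProduct.tmul_add, map_add]; rfl

instance : Module Sᵐᵒᵖ (Ind φ V) := Module.compHom (Ind φ V) (indAct φ V)

variable {V} in
lemma op_smul_indTmul (v : V) (s s' : S) :
    MulOpposite.op s • indTmul φ v s' = indTmul φ v (s' * s) := rfl

instance : SMulCommClass Sᵐᵒᵖ k (Ind φ V) where
  smul_comm s c v := (indAct φ V s).map_smul c v

instance : IsScalarTower k Sᵐᵒᵖ (Ind φ V) where
  smul_assoc c s v := by
    have h : indAct φ V (c • s) = c • indAct φ V s := by
      apply ind_hom_ext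
      intro v s'
      change indTmul φ v (s' * (c • s.unop)) = c • indTmul φ v (s' * s.unop)
      rw [indTmul, mul_smul_comm, TensorProduct.tmul_smul, map_smul]; rfl
    exact LinearMap.congr_fun h v

end InducedModules

section PermutationModule

variable (k : Type u) [CommRing k]

/-- The trivial right module of rank one over the group algebra of `G`. -/
def TrivMod (_G : Type) : Type u := k

instance (G : Type) : AddCommGroup (TrivMod k G) := inferInstanceAs (AddCommGroup k)

instance (G : Type) : Module k (TrivMod k G) := inferInstanceAs (Module k k)

/-- The augmentation map of the group algebra, sending every group element to `1`. -/
def augmentation (G : Type) [Group G] : MonoidAlgebra k G →ₐ[k] k :=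
  MonoidAlgebra.lift k k G 1

instance (G : Type) [Group G] : Module (MonoidAlgebra k G)ᵐᵒᵖ (TrivMod k G) :=
  Module.compHom k ((augmentation k G : MonoidAlgebra k G →+* k).fromOpposite
    fun _ _ => Commute.all _ _)

/-- `a` lies in the `i`th block of `λ`: `λ₁ + ⋯ + λ_{i-1} ≤ a < λ₁ + ⋯ + λ_i`
(positions starting at `0`). -/
def InBlock {n : ℕ} (lam : Fin n → ℕ) (i : Fin n) (a : ℕ) : Prop :=
  ∑ j ∈ Finset.Iio i, lam j ≤ a ∧ a < ∑ j ∈ Finset.Iic i, lam j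

/-- The parabolic (Young) subgroup `S_λ = S_{λ₁} × ⋯ × S_{λ_n}` of `S_r`: the permutations
preserving each block of `λ`. -/
def youngSubgroup (r : ℕ) {n : ℕ} (lam : Fin n → ℕ) : Subgroup (Equiv.Perm (Fin r)) where
  carrier := {w | ∀ (i : Fin n) (a : Fin r), InBlock lam i (w a) ↔ InBlock lam i a}
  one_mem' := fun _ _ => Iff.rfl
  mul_mem' := fun {u v} hu hv i a => (hu i (v a)).trans (hv i a)
  inv_mem' := fun {u} hu i a => by
    have h := hu i (u⁻¹ a)
    rw [← Equiv.Perm.mul_apply, mul_inv_cancel, Equiv.Perm.one_apply] at h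
    exact h.symm

/-- The inclusion of the group algebra of `S_λ` into that of `S_r`. -/
def youngIncl (r : ℕ) {n : ℕ} (lam : Fin n → ℕ) :
    MonoidAlgebra k (youngSubgroup r lam) →ₐ[k] MonoidAlgebra k (Equiv.Perm (Fin r)) :=
  MonoidAlgebra.mapDomainAlgHom k k (youngSubgroup r lam).subtype

/-- The permutation module `M(λ) = k_λ ⊗_{k S_λ} k S_r`, a right `k S_r`-module. -/
abbrev PermMod (r : ℕ) {n : ℕ} (lam : Fin n → ℕ) : Type u :=
  Ind (youngIncl k r lam) (TrivMod k (youngSubgroup r lam))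

/-- The generator `m_λ = 1 ⊗ 1` of `M(λ)`. -/
def permModGen (r : ℕ) {n : ℕ} (lam : Fin n → ℕ) : PermMod k r lam :=
  indTmul (youngIncl k r lam) (show TrivMod k (youngSubgroup r lam) from (1 : k)) 1

end PermutationModule

section HeckeAlgebra

/-! ### The degenerate affine Hecke algebra -/

variable (k : Type u) [CommRing k] (r : ℕ)

/-- The generators `x_1, …, x_r` and `s_1, …, s_{r-1}`, with indices starting at `0`. -/
inductive AHGen (r : ℕ) : Type
  | x (i : ℕ) (hi : i < r) : AHGen r
  | s (i : ℕ) (hi : i + 1 < r) : AHGen r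

/-- The free generator `x_i`. -/
abbrev fx {r : ℕ} (i : ℕ) (hi : i < r) : FreeAlgebra k (AHGen r) := FreeAlgebra.ι k (AHGen.x i hi)

/-- The free generator `s_i`. -/
abbrev fs {r : ℕ} (i : ℕ) (hi : i + 1 < r) : FreeAlgebra k (AHGen r) :=
  FreeAlgebra.ι k (AHGen.s i hi)

/-- The defining relations of the degenerate affine Hecke algebra. -/
inductive AHRel : FreeAlgebra k (AHGen r) → FreeAlgebra k (AHGen r) → Prop
  | x_comm (i j : ℕ) (hi : i < r) (hj : j < r) : AHRel (fx k i hi * fx k j hj) (fx k j hj * fx k i hi)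
  | s_sq (i : ℕ) (hi : i + 1 < r) : AHRel (fs k i hi * fs k i hi) 1
  | s_comm (i j : ℕ) (hi : i + 1 < r) (hj : j + 1 < r) (hij : i + 1 < j) :
      AHRel (fs k i hi * fs k j hj) (fs k j hj * fs k i hi)
  | s_braid (i : ℕ) (hi : i + 1 < r) (hi' : i + 1 + 1 < r) :
      AHRel (fs k i hi * fs k (i + 1) hi' * fs k i hi)
        (fs k (i + 1) hi' * fs k i hi * fs k (i + 1) hi')
  | s_x (i : ℕ) (hi : i < r) (hi' : i + 1 < r) :
      AHRel (fs k i hi' * fx k i hi) (fx k (i + 1) hi' * fs k i hi' + 1)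
  | x_s (i : ℕ) (hi : i < r) (hi' : i + 1 < r) :
      AHRel (fx k i hi * fs k i hi') (fs k i hi' * fx k (i + 1) hi' + 1)
  | x_s_comm (i j : ℕ) (hi : i < r) (hj : j + 1 < r) (h₁ : i ≠ j) (h₂ : i ≠ j + 1) :
      AHRel (fx k i hi * fs k j hj) (fs k j hj * fx k i hi)

/-- The degenerate affine Hecke algebra `AH_r`. -/
def AH : Type u := RingQuot (AHRel k r)

instance : Ring (AH k r) := inferInstanceAs (Ring (RingQuot (AHRel k r)))

instance : Algebra k (AH k r) := inferInstanceAs (Algebra k (RingQuot (AHRel k r)))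

/-- The quotient map from the free algebra. -/
def AH.mk : FreeAlgebra k (AHGen r) →ₐ[k] AH k r := RingQuot.mkAlgHom k (AHRel k r)

variable {r} in
lemma AH.mk_rel {a b : FreeAlgebra k (AHGen r)} (h : AHRel k r a b) : AH.mk k r a = AH.mk k r b :=
  RingQuot.mkAlgHom_rel k h

variable {r} in
/-- The element `x_i` of `AH_r`. -/
def AH.x (i : Fin r) : AH k r := AH.mk k r (fx k i i.isLt)

variable {r} in
/-- The element `s_i` of `AH_r`. -/
def AH.s (i : ℕ) (hi : i + 1 < r) : AH k r := AH.mk k r (fs k i hi)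

lemma AH.coxRel : CoxRel (fun i => if h : i + 1 < r then AH.s k i h else (1 : AH k r)) (r - 1) where
  sq i hi := by
    have h : i + 1 < r := by omega
    simpa [h, AH.s] using AH.mk_rel k (AHRel.s_sq i h)
  comm i j hij hj := by
    have h : i + 1 < r := by omega
    have h' : j + 1 < r := by omega
    simpa [h, h', AH.s] using AH.mk_rel k (AHRel.s_comm i j h h' hij)
  braid i hi := by
    have h : i + 1 < r := by omega
    have h' : i + 1 + 1 < r := by omega
    simpa [h, h', AH.s] using AH.mk_rel k (AHRel.s_braid i h h')

lemma AH.exists_permHom : ∃ φ : Equiv.Perm (Fin r) →* AH k r,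
    ∀ i (hi : i + 1 < r), φ (basicSwap i hi) = AH.s k i hi := by
  obtain ⟨φ, hφ⟩ := AffSchur.exists_permHom r _ (AH.coxRel k r)
  exact ⟨φ, fun i hi => by rw [hφ i hi, dif_pos hi]⟩

/-- The homomorphism `S_r → AH_r` sending the basic transposition `(i  i+1)` to `s_i`. -/
def AH.permHom : Equiv.Perm (Fin r) →* AH k r := (AH.exists_permHom k r).choose

lemma AH.permHom_basicSwap (i : ℕ) (hi : i + 1 < r) :
    AH.permHom k r (basicSwap i hi) = AH.s k i hi :=
  (AH.exists_permHom k r).choose_spec i hi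

/-- The algebra map `k S_r → AH_r`. -/
def AH.ofGroupAlg : MonoidAlgebra k (Equiv.Perm (Fin r)) →ₐ[k] AH k r :=
  MonoidAlgebra.lift k (AH k r) (Equiv.Perm (Fin r)) (AH.permHom k r)

lemma AH.x_comm (a : AH k r) (ha : a ∈ Set.range (AH.x k (r := r))) (b : AH k r)
    (hb : b ∈ Set.range (AH.x k (r := r))) : a * b = b * a := by
  obtain ⟨i, rfl⟩ := ha
  obtain ⟨j, rfl⟩ := hb
  simpa [AH.x] using AH.mk_rel k (AHRel.x_comm i j i.isLt j.isLt)

open scoped IsMulCommutative in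
/-- The algebra map `P_r = k[x_1, …, x_r] → AH_r`. -/
def AH.ofPoly : MvPolynomial (Fin r) k →ₐ[k] AH k r :=
  haveI := Algebra.isMulCommutative_adjoin k (AH.x_comm k r)
  (Algebra.adjoin k (Set.range (AH.x k (r := r)))).val.comp
    (MvPolynomial.aeval fun i => ⟨AH.x k i, Algebra.subset_adjoin ⟨i, rfl⟩⟩)

lemma AH.ofPoly_X (i : Fin r) : AH.ofPoly k r (MvPolynomial.X i) = AH.x k i := by
  simp [AH.ofPoly]

/-- The right `AH_r`-module `M(λ) ⊗_{k S_r} AH_r`. -/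
abbrev IndPermMod {n : ℕ} (lam : Fin n → ℕ) : Type u :=
  Ind (AH.ofGroupAlg k r) (PermMod k r lam)

/-- The vector `m_λ ⊗ a` of `M(λ) ⊗_{k S_r} AH_r`. -/
def genTmul {n : ℕ} (lam : Fin n → ℕ) (a : AH k r) : IndPermMod k r lam :=
  indTmul (AH.ofGroupAlg k r) (permModGen k r lam) a

end HeckeAlgebra

section Category

/-! ### The degenerate affine Schur category -/

open CategoryTheory

variable (k : Type u) [CommRing k]

/-- The objects of the degenerate affine Schur category: compositions `λ = (λ_1, …, λ_n)`,
`λ_i ∈ ℕ`, of arbitrary length `n ≥ 0`. -/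
structure ASchur (k : Type u) where
  /-- the length of the composition -/
  len : ℕ
  /-- the parts of the composition -/
  parts : Fin len → ℕ

namespace ASchur

variable {k}

/-- `|λ|`, the sum of the parts. -/
def size (X : ASchur k) : ℕ := ∑ i, X.parts i

/-- The morphisms `μ → λ`.  If `|μ| = |λ| = r` such a family has a single member, an
`AH_r`-module homomorphism `M(μ) ⊗ AH_r → M(λ) ⊗ AH_r`; if `|μ| ≠ |λ|` then there is no such `r`
and the only family is the empty one, so the module of morphisms is `0`. -/
@[ext]
structure Hom (X Y : ASchur k) : Type u where
  /-- the component in the degree `r = |μ| = |λ|` -/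
  app : ∀ r : ℕ, X.size = r → Y.size = r →
    (IndPermMod k r X.parts →ₗ[(AH k r)ᵐᵒᵖ] IndPermMod k r Y.parts)

/-- The identity morphism `1_λ`. -/
def Hom.id (X : ASchur k) : Hom X X := ⟨fun _ _ _ => LinearMap.id⟩

/-- Composition of morphisms, which is composition of module homomorphisms (first `f`, then `g`),
and is `0` when the degrees do not match. -/
def Hom.comp {X Y Z : ASchur k} (f : Hom X Y) (g : Hom Y Z) : Hom X Z :=
  ⟨fun r hX hZ => if hY : Y.size = r then (g.app r hY hZ).comp (f.app r hX hY) else 0⟩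

lemma Hom.comp_app {X Y Z : ASchur k} (f : Hom X Y) (g : Hom Y Z) (r : ℕ) (hX : X.size = r)
    (hY : Y.size = r) (hZ : Z.size = r) :
    (f.comp g).app r hX hZ = (g.app r hY hZ).comp (f.app r hX hY) :=
  dif_pos hY

lemma Hom.comp_app_of_ne {X Y Z : ASchur k} (f : Hom X Y) (g : Hom Y Z) (r : ℕ) (hX : X.size = r)
    (hY : Y.size ≠ r) (hZ : Z.size = r) : (f.comp g).app r hX hZ = 0 :=
  dif_neg hY

lemma Hom.id_comp {X Y : ASchur k} (f : Hom X Y) : (Hom.id X).comp f = f := by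
  apply Hom.ext; funext r hX hY; rw [Hom.comp_app _ _ r hX hX hY]; exact LinearMap.comp_id _

lemma Hom.comp_id {X Y : ASchur k} (f : Hom X Y) : f.comp (Hom.id Y) = f := by
  apply Hom.ext; funext r hX hY; rw [Hom.comp_app _ _ r hX hY hY]; exact LinearMap.id_comp _

lemma Hom.assoc {W X Y Z : ASchur k} (f : Hom W X) (g : Hom X Y) (h : Hom Y Z) :
    (f.comp g).comp h = f.comp (g.comp h) := by
  apply Hom.ext; funext r hW hZ
  by_cases hX : X.size = r
  · rw [Hom.comp_app f _ r hW hX hZ]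
    by_cases hY : Y.size = r
    · rw [Hom.comp_app _ h r hW hY hZ, Hom.comp_app f g r hW hX hY, Hom.comp_app g h r hX hY hZ]
      exact (LinearMap.comp_assoc _ _ _).symm
    · rw [Hom.comp_app_of_ne _ h r hW hY hZ, Hom.comp_app_of_ne g h r hX hY hZ]
      exact (LinearMap.zero_comp _).symm
  · rw [Hom.comp_app_of_ne f _ r hW hX hZ]
    by_cases hY : Y.size = r
    · rw [Hom.comp_app _ h r hW hY hZ, Hom.comp_app_of_ne f g r hW hX hY]
      exact LinearMap.comp_zero _
    · rw [Hom.comp_app_of_ne _ h r hW hY hZ]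

instance : Category.{u} (ASchur k) where
  Hom := Hom
  id := Hom.id
  comp := Hom.comp
  id_comp := Hom.id_comp
  comp_id := Hom.comp_id
  assoc := Hom.assoc

/-- The `AH_r`-module homomorphism underlying a morphism. -/
def app {X Y : ASchur k} (f : X ⟶ Y) (r : ℕ) (hX : X.size = r) (hY : Y.size = r) :
    IndPermMod k r X.parts →ₗ[(AH k r)ᵐᵒᵖ] IndPermMod k r Y.parts :=
  Hom.app f r hX hY

@[ext]
lemma hom_ext {X Y : ASchur k} {f g : X ⟶ Y} (h : ∀ r hX hY, app f r hX hY = app g r hX hY) :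
    f = g :=
  Hom.ext (funext fun r => funext fun hX => funext fun hY => h r hX hY)

lemma app_comp {X Y Z : ASchur k} (f : X ⟶ Y) (g : Y ⟶ Z) (r : ℕ) (hX : X.size = r)
    (hY : Y.size = r) (hZ : Z.size = r) :
    app (f ≫ g) r hX hZ = (app g r hY hZ).comp (app f r hX hY) :=
  dif_pos hY

lemma app_comp_of_ne {X Y Z : ASchur k} (f : X ⟶ Y) (g : Y ⟶ Z) (r : ℕ) (hX : X.size = r)
    (hY : Y.size ≠ r) (hZ : Z.size = r) :
    app (f ≫ g) r hX hZ = 0 :=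
  dif_neg hY

/-- Morphisms as families of module homomorphisms; the linear structure is the pointwise one. -/
def homEquiv (X Y : ASchur k) : (X ⟶ Y) ≃ (∀ r : {r : ℕ // X.size = r ∧ Y.size = r},
    (IndPermMod k r X.parts →ₗ[(AH k r)ᵐᵒᵖ] IndPermMod k r Y.parts)) where
  toFun f r := app f r r.2.1 r.2.2
  invFun f := ⟨fun r hX hY => f ⟨r, hX, hY⟩⟩
  left_inv _ := rfl
  right_inv _ := rfl

instance (X Y : ASchur k) : AddCommGroup (X ⟶ Y) := (homEquiv X Y).addCommGroup

instance (X Y : ASchur k) : Module k (X ⟶ Y) := (homEquiv X Y).module k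

@[simp]
lemma app_add {X Y : ASchur k} (f g : X ⟶ Y) (r : ℕ) (hX : X.size = r) (hY : Y.size = r) :
    app (f + g) r hX hY = app f r hX hY + app g r hX hY := rfl

@[simp]
lemma app_smul {X Y : ASchur k} (c : k) (f : X ⟶ Y) (r : ℕ) (hX : X.size = r)
    (hY : Y.size = r) : app (c • f) r hX hY = c • app f r hX hY := rfl

instance : Preadditive (ASchur k) where
  add_comp X Y Z f f' g := by
    ext r hX hZ : 3
    by_cases hY : Y.size = r
    · simp [app_comp _ _ r hX hY hZ, LinearMap.comp_add]
    · simp [app_comp_of_ne _ _ r hX hY hZ]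
  comp_add X Y Z f g g' := by
    ext r hX hZ : 3
    by_cases hY : Y.size = r
    · simp [app_comp _ _ r hX hY hZ, LinearMap.add_comp]
    · simp [app_comp_of_ne _ _ r hX hY hZ]

instance : Linear k (ASchur k) where
  smul_comp X Y Z c f g := by
    ext r hX hZ : 3
    by_cases hY : Y.size = r
    · simp [app_comp _ _ r hX hY hZ, LinearMap.comp_smul]
    · simp [app_comp_of_ne _ _ r hX hY hZ]
  comp_smul X Y Z f c g := by
    ext r hX hZ : 3
    by_cases hY : Y.size = r
    · simp [app_comp _ _ r hX hY hZ, LinearMap.smul_comp]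
    · simp [app_comp_of_ne _ _ r hX hY hZ]

end ASchur

/-- The endomorphism `φ` of the composition `λ` of `r` is `f 1_λ`: the right `AH_r`-module
endomorphism of `M(λ) ⊗_{k S_r} AH_r` sending `m_λ ⊗ 1` to `m_λ ⊗ f`. As `m_λ ⊗ 1` generates the
module there is at most one such endomorphism. -/
def IsPinned {X : ASchur k} {r : ℕ} (hr : X.size = r) (f : MvPolynomial (Fin r) k)
    (φ : End X) : Prop :=
  ASchur.app φ r hr hr (genTmul k r X.parts 1) = genTmul k r X.parts (AH.ofPoly k r f)

end Category

end AffSchur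

end

/-!
Write `W` for the symmetric group, `P` for the polynomial ring, `A` for `AH_r`, `m` for the
generator `m_λ ⊗ 1` of `N = M(λ) ⊗ A`, and let `W` act on `P` by permuting the variables. The module
`N` is the quotient of the right module `A` by the relations `u a = a` for `u ∈ S_λ`, so an
endomorphism is the same as an element of `N` fixed by right multiplication with `S_λ`
(`exists_lift`, `exists_endo`). Symmetric polynomials are central in `A`, because
`p s = s (s p) + divDiff p` and the divided difference of a symmetric polynomial vanishes. Hence
they act by central endomorphisms, and the point is that there are no others.

A basis theorem is needed first. The operators `regX` and `regS` make the functions `W → P` into a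
right `A`-module; the relations of `A` hold because both sides of each of them move past the
variables in the same way and agree on the group elements (`reg_ext`). Mapping `m` to the indicator
function of `S_λ` gives coordinates on `N` (`coord`), which show that the elements `m w`, for `w` in
a set of representatives of `S_λ \ W`, form a basis of `N` over `P` (`genTmul_sum_cosetReps`).

Filter `A` and `N` by the degree in the variables. Since `p w = w (w⁻¹ p)` up to lower degree
(`AH.ofPoly_mul_perm_sub_mem`), leading terms are computed in the skew group ring. Let `z` be
central of degree `d` and let `v = z m`. For `g ∈ P` and `w ∈ W` there is the endomorphism `m ↦ m
w g ∑ u`, the sum being over `u ∈ S_λ`. Let `g` be a monomial with distinct exponents, so that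
every combination of the translates of `g` with coefficients `0`, `1` or `-1`, not all `0`, is a
nonzero divisor over any commutative ring. For `w = 1` the symbol of this endomorphism is
multiplication by the trace of `g`, and commuting with it forces the leading term of `v` to be `m
p` for a homogeneous `p ∈ P` (`exists_leading_of_central`). As `v` is fixed by `S_λ`, so is `p`.
Commuting with the endomorphism for a general `w` gives `G (w⁻¹ p - p) = 0`, where `G` is the sum
of the translates `u⁻¹ g` over the `u ∈ S_λ` that stabilize the coset `S_λ w`; hence `p` is
symmetric (`leading_isSymmetric`). Now `z` minus multiplication by `p` is central of smaller
degree, and induction on the degree finishes the proof (`exists_symmetric_of_central`).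
-/

noncomputable section

namespace AffSchur

open MvPolynomial

section Polynomials

/-! ### Degrees, nonzero divisors and divided differences of polynomials -/

universe u

variable {k : Type u} [CommRing k] {σ : Type*}

/-- A polynomial whose coefficients are all `0` or units, and not all `0`, is a nonzero divisor over
any commutative ring: its leading coefficient for the lexicographic order is a unit. -/
lemma mul_eq_zero_of_coeff_zero_or_unit {r : ℕ} {G h : MvPolynomial (Fin r) k}
    (hG : ∀ n, coeff n G = 0 ∨ IsUnit (coeff n G)) (hu : ∃ n, IsUnit (coeff n G))
    (hmul : G * h = 0) : h = 0 := by
  nontriviality k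
  have hG0 : G ≠ 0 := by
    rintro rfl
    obtain ⟨n, hn⟩ := hu
    simp at hn
  have hlc : IsUnit (MonomialOrder.lex.leadingCoeff G) :=
    (hG _).resolve_left (MonomialOrder.lex.leadingCoeff_ne_zero_iff.2 hG0)
  have := MonomialOrder.lex.leadingCoeff_mul_of_isRegular_left (g := h) hlc.isRegular
  rw [hmul, MonomialOrder.leadingCoeff_zero] at this
  exact MonomialOrder.lex.leadingCoeff_eq_zero_iff.1 ((hlc.mul_right_eq_zero).1 this.symm)

variable (k σ) in
/-- The polynomials of degree less than `d`.  The zero polynomial is the only one for `d = 0`. -/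
def lowDeg (d : ℕ) : Submodule k (MvPolynomial σ k) := restrictSupport k {n | n.degree < d}

lemma mem_lowDeg {d : ℕ} {p : MvPolynomial σ k} :
    p ∈ lowDeg k σ d ↔ ∀ n, coeff n p ≠ 0 → n.degree < d := by
  rw [lowDeg, mem_restrictSupport_iff]
  simp [Set.subset_def]

lemma lowDeg_mono {d e : ℕ} (h : d ≤ e) : lowDeg k σ d ≤ lowDeg k σ e :=
  restrictSupport_mono k fun _ hn => lt_of_lt_of_le hn h

lemma eq_zero_of_mem_lowDeg_zero {p : MvPolynomial σ k} (h : p ∈ lowDeg k σ 0) : p = 0 := by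
  ext n
  by_contra hn
  exact absurd (mem_lowDeg.1 h n hn) (by omega)

open scoped Pointwise in
/-- Degrees below `a` and at most `b` multiply to degrees below `a + b`; the bound on `q` is written
`b + 1` since `lowDeg` is a strict bound. -/
lemma mul_mem_lowDeg {a b : ℕ} {p q : MvPolynomial σ k} (hp : p ∈ lowDeg k σ a)
    (hq : q ∈ lowDeg k σ (b + 1)) : p * q ∈ lowDeg k σ (a + b) := by
  have h : p * q ∈ restrictSupport k
      ({n : σ →₀ ℕ | n.degree < a} + {n : σ →₀ ℕ | n.degree < b + 1}) := by
    rw [restrictSupport_add]; exact Submodule.mul_mem_mul hp hq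
  refine restrictSupport_mono k ?_ h
  rintro _ ⟨m, hm, n, hn, rfl⟩
  simp only [Set.mem_ofPred_eq, map_add] at *
  omega

lemma rename_mem_lowDeg (e : Equiv.Perm σ) {d : ℕ} {p : MvPolynomial σ k}
    (hp : p ∈ lowDeg k σ d) : rename e p ∈ lowDeg k σ d := by
  rw [mem_lowDeg] at hp ⊢
  intro n hn
  obtain ⟨m, rfl, hm⟩ := coeff_rename_ne_zero _ _ _ hn
  rw [Finsupp.degree_mapDomain]
  exact hp m hm

lemma mem_lowDeg_of_isHomogeneous {d : ℕ} {p : MvPolynomial σ k} (hp : p.IsHomogeneous d) :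
    p ∈ lowDeg k σ (d + 1) := by
  rw [mem_lowDeg]
  intro n hn
  by_contra hc
  exact hn (hp.coeff_eq_zero (by omega))

lemma eq_zero_of_isHomogeneous_of_mem_lowDeg {d : ℕ} {p : MvPolynomial σ k}
    (hp : p.IsHomogeneous d) (h : p ∈ lowDeg k σ d) : p = 0 := by
  ext n
  by_contra hn
  have h1 := mem_lowDeg.1 h n hn
  exact hn (hp.coeff_eq_zero (by omega))

lemma sub_homogeneousComponent_mem_lowDeg {d : ℕ} {p : MvPolynomial σ k}
    (hp : p ∈ lowDeg k σ (d + 1)) : p - homogeneousComponent d p ∈ lowDeg k σ d := by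
  rw [mem_lowDeg] at hp ⊢
  intro n hn
  rw [coeff_sub, coeff_homogeneousComponent] at hn
  split_ifs at hn with h
  · simp at hn
  · have := hp n (by simpa using hn)
    omega

/-- If `G` is a homogeneous nonzero divisor of degree `e` and `G * p` has degree less than `d + e`,
then `p` has degree less than `d`. -/
lemma mem_lowDeg_of_mul_mem {r d e : ℕ} {G p : MvPolynomial (Fin r) k}
    (hGe : G.IsHomogeneous e)
    (hG : ∀ n, coeff n G = 0 ∨ IsUnit (coeff n G)) (hu : ∃ n, IsUnit (coeff n G))
    (hp : p ∈ lowDeg k (Fin r) (d + 1)) (h : G * p ∈ lowDeg k (Fin r) (d + e)) :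
    p ∈ lowDeg k (Fin r) d := by
  have h1 := sub_homogeneousComponent_mem_lowDeg hp
  have h2 : G * homogeneousComponent d p ∈ lowDeg k (Fin r) (d + e) := by
    have h3 := mul_mem_lowDeg h1 (mem_lowDeg_of_isHomogeneous hGe)
    have : G * homogeneousComponent d p
        = G * p - (p - homogeneousComponent d p) * G := by ring
    rw [this]
    exact sub_mem h h3
  have h4 := eq_zero_of_isHomogeneous_of_mem_lowDeg
    (hGe.mul (homogeneousComponent_isHomogeneous d p)) (by rwa [add_comm] at h2)
  have h5 := mul_eq_zero_of_coeff_zero_or_unit hG hu h4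
  rwa [h5, sub_zero] at h1

section DividedDifference

variable [DecidableEq σ]

/-- The substitution `x_a ↦ x_a - t`, `x_b ↦ x_b + t`, which is the identity for `t = 0` and the
transposition of `x_a` and `x_b` for `t = x_a - x_b`. -/
def swapHomotopy (a b : σ) : MvPolynomial σ k →ₐ[k] Polynomial (MvPolynomial σ k) :=
  aeval fun c => Polynomial.C (X c) +
    (if c = a then -Polynomial.X else if c = b then Polynomial.X else 0)

lemma coeff_zero_swapHomotopy (a b : σ) (p : MvPolynomial σ k) :
    (swapHomotopy a b p).coeff 0 = p := by
  have : (Polynomial.aeval (R := MvPolynomial σ k) (0 : MvPolynomial σ k)).toRingHom.comp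
      (swapHomotopy (k := k) a b).toRingHom = RingHom.id _ := by
    ext c
    · simp [swapHomotopy, MvPolynomial.algebraMap_eq]
    · simp only [swapHomotopy]
      simp
      split_ifs <;> simp
  have h := RingHom.congr_fun this p
  rw [Polynomial.coeff_zero_eq_aeval_zero]
  simpa using h

lemma eval_swapHomotopy {a b : σ} (hab : a ≠ b) (p : MvPolynomial σ k) :
    (swapHomotopy a b p).eval (X a - X b) = rename (Equiv.swap a b) p := by
  have : (Polynomial.evalRingHom (X a - X b : MvPolynomial σ k)).comp
      (swapHomotopy (k := k) a b).toRingHom = (rename (Equiv.swap a b)).toRingHom := by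
    ext c
    · simp [swapHomotopy, MvPolynomial.algebraMap_eq]
    · simp only [swapHomotopy]
      by_cases h1 : c = a
      · subst h1; simp
      · by_cases h2 : c = b
        · subst h2; simp [h1]
        · simp [h1, h2, Equiv.swap_apply_of_ne_of_ne h1 h2]
  exact RingHom.congr_fun this p

/-- The divided difference `(p - s p) / (x_a - x_b)`, where `s` swaps `x_a` and `x_b`. Up to the
sign it is obtained by dividing `p(x_a - t, x_b + t) - p` by `t` before setting `t = x_a - x_b`,
so that no division in the polynomial ring is needed. -/
def divDiff (a b : σ) : MvPolynomial σ k →ₗ[k] MvPolynomial σ k where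
  toFun p := -(swapHomotopy a b p).divX.eval (X a - X b)
  map_add' p q := by simp [Polynomial.divX_add]; ring
  map_smul' c p := by
    have : (c • swapHomotopy a b p).divX = c • (swapHomotopy a b p).divX := by
      ext1 n; simp [Polynomial.coeff_divX]
    simp [this]

lemma mul_divDiff {a b : σ} (hab : a ≠ b) (p : MvPolynomial σ k) :
    (X a - X b) * divDiff a b p = p - rename (Equiv.swap a b) p := by
  have h := congrArg (Polynomial.eval (X a - X b))
    (Polynomial.X_mul_divX_add (swapHomotopy a b p))
  rw [coeff_zero_swapHomotopy, eval_swapHomotopy hab] at h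
  simp only [Polynomial.eval_add, Polynomial.eval_mul, Polynomial.eval_X, Polynomial.eval_C] at h
  rw [← h]
  simp [divDiff]

/-- The twisted Leibniz rule. -/
lemma divDiff_mul {a b : σ} (hab : a ≠ b) (p q : MvPolynomial σ k) :
    divDiff a b (p * q) = divDiff a b p * rename (Equiv.swap a b) q + p * divDiff a b q := by
  have h : (swapHomotopy a b p * swapHomotopy a b q).divX
      = (swapHomotopy a b p).divX * swapHomotopy a b q
        + Polynomial.C p * (swapHomotopy a b q).divX := by
    have hp := Polynomial.X_mul_divX_add (swapHomotopy a b p)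
    have hq := Polynomial.X_mul_divX_add (swapHomotopy a b q)
    have hpq := Polynomial.X_mul_divX_add (swapHomotopy a b p * swapHomotopy a b q)
    rw [Polynomial.mul_coeff_zero] at hpq
    rw [coeff_zero_swapHomotopy] at hp hq hpq
    rw [coeff_zero_swapHomotopy] at hpq
    rw [Polynomial.C_mul] at hpq
    refine Polynomial.isRegular_X.left ?_
    simp only
    linear_combination hpq - swapHomotopy a b q * hp - Polynomial.C p * hq
  simp only [divDiff, LinearMap.coe_mk, AddHom.coe_mk, map_mul, h, Polynomial.eval_add,
    Polynomial.eval_mul, Polynomial.eval_C, eval_swapHomotopy hab]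
  ring

lemma divDiff_C (a b : σ) (c : k) : divDiff a b (C c : MvPolynomial σ k) = 0 := by
  have h : swapHomotopy a b (C c : MvPolynomial σ k) = Polynomial.C (C c) := by
    simp [swapHomotopy, ← MvPolynomial.algebraMap_eq]
  simp [divDiff, h]

lemma divDiff_X (a b c : σ) :
    divDiff a b (X c : MvPolynomial σ k) = if c = a then 1 else if c = b then -1 else 0 := by
  simp only [divDiff, swapHomotopy, LinearMap.coe_mk, AddHom.coe_mk, aeval_X, Polynomial.divX_add,
    Polynomial.divX_C, zero_add]
  have hX : (Polynomial.X : Polynomial (MvPolynomial σ k)).divX = 1 := by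
    ext1 n; simp [Polynomial.coeff_divX, Polynomial.coeff_X, Polynomial.coeff_one]
  have hX' : (-Polynomial.X : Polynomial (MvPolynomial σ k)).divX = -1 := by
    ext1 n
    simp [Polynomial.coeff_divX, Polynomial.coeff_X, Polynomial.coeff_one]
  split_ifs <;> simp [hX, hX']

lemma divDiff_monomial_mem {a b : σ} (hab : a ≠ b) (n : σ →₀ ℕ) (c : k) :
    divDiff a b (monomial n c) ∈ lowDeg k σ n.degree := by
  induction hN : n.degree generalizing n with
  | zero =>
    obtain rfl := (Finsupp.degree_eq_zero_iff n).1 hN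
    rw [← C_apply, divDiff_C]
    exact zero_mem _
  | succ N ih =>
    -- split off one variable and use the Leibniz rule
    obtain ⟨i, hi⟩ : ∃ i, n i ≠ 0 := by
      by_contra! h
      obtain rfl : n = 0 := Finsupp.ext h
      simp at hN
    have hn : n = Finsupp.single i 1 + (n - Finsupp.single i 1) :=
      (add_tsub_cancel_of_le (Finsupp.single_le_iff.2 (Nat.one_le_iff_ne_zero.2 hi))).symm
    have hdeg : (n - Finsupp.single i 1).degree = N := by
      have := congrArg Finsupp.degree hn
      rw [map_add, Finsupp.degree_single] at this
      omega
    have hm : monomial n c = X i * monomial (n - Finsupp.single i 1) c := by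
      rw [X, monomial_mul, ← hn, one_mul]
    rw [hm, divDiff_mul hab]
    refine add_mem ?_ ?_
    · rw [divDiff_X, ← smul_eq_mul]
      have h1 : rename (Equiv.swap a b) (monomial (n - Finsupp.single i 1) c)
          ∈ lowDeg k σ (N + 1) :=
        rename_mem_lowDeg _ (mem_lowDeg_of_isHomogeneous (isHomogeneous_monomial c hdeg))
      split_ifs
      · simpa using h1
      · simpa using h1
      · simp
    · rw [mul_comm]
      exact mul_mem_lowDeg (ih _ hdeg) (mem_lowDeg_of_isHomogeneous (isHomogeneous_X k i))

/-- Divided differences lower the degree. -/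
lemma divDiff_mem_lowDeg {a b : σ} (hab : a ≠ b) {d : ℕ} {p : MvPolynomial σ k}
    (hp : p ∈ lowDeg k σ (d + 1)) : divDiff a b p ∈ lowDeg k σ d := by
  rw [p.as_sum, map_sum]
  refine sum_mem fun n hn => ?_
  have h1 := mem_lowDeg.1 hp n (mem_support_iff.1 hn)
  exact lowDeg_mono (by omega) (divDiff_monomial_mem hab n _)

end DividedDifference

lemma divDiff_eq_zero {r : ℕ} {a b : Fin r} (hab : a ≠ b) {p : MvPolynomial (Fin r) k}
    (hp : rename (Equiv.swap a b) p = p) : divDiff a b p = 0 := by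
  refine mul_eq_zero_of_coeff_zero_or_unit (G := X a - X b) ?_ ⟨Finsupp.single a 1, ?_⟩
    (by rw [mul_divDiff hab, hp, sub_self])
  · intro n
    simp only [coeff_sub, coeff_X]
    have : Finsupp.single a 1 ≠ Finsupp.single b 1 := fun h =>
      hab (Finsupp.single_left_injective one_ne_zero h)
    split_ifs <;> simp
  · have : Finsupp.single b 1 ≠ Finsupp.single a 1 := fun h =>
      hab (Finsupp.single_left_injective one_ne_zero h).symm
    simp [coeff_X, this]

end Polynomials

section TwistedCommutation

/-! ### Words in reflections moved past a variable -/

variable {R : Type*} [Ring R] {S T x y z e f : R}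

lemma commute_ite_neg_one (u : R) (p q : Prop) [Decidable p] [Decidable q] :
    Commute u (if p then 1 else if q then -1 else 0) := by
  split_ifs
  exacts [Commute.one_right _, Commute.neg_one_right _, Commute.zero_right _]

lemma sq_mul_comm (h₁ : S * x = y * S + e) (h₂ : S * y = x * S - e) (he : Commute S e) :
    S * S * x = x * (S * S) := by
  rw [mul_assoc, h₁, mul_add, ← mul_assoc, h₂, he.eq]
  noncomm_ring

/-- If `S` and `T` move past the variables up to scalar corrections `e` and `f`, their commutator
moves past `x` without any correction. -/
lemma comm_mul_twist {y' : R} (h₁ : T * x = y * T + e) (h₂ : S * y = z * S + f)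
    (h₃ : S * x = y' * S + f) (h₄ : T * y' = z * T + e) (hS : Commute S e) (hT : Commute T f) :
    (S * T - T * S) * x = z * (S * T - T * S) := by
  rw [sub_mul, mul_assoc, h₁, mul_add, ← mul_assoc, h₂, mul_assoc T, h₃, mul_add, ← mul_assoc T,
    h₄, hS.eq, hT.eq]
  noncomm_ring

/-- The four lemmas on the braid defect `S T S - T S T` concern reflections `S`, `T` in the pairs of
variables `(x, y)` and `(y, z)`: moving the defect past a variable leaves no correction terms. -/
lemma braid_mul_first (hS : S * S = 1) (hT : T * T = 1) (h₁ : S * x = y * S + 1)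
    (h₂ : T * y = z * T + 1) (h₃ : T * x = x * T) (h₄ : S * z = z * S) :
    (S * T * S - T * S * T) * x = z * (S * T * S - T * S * T) := by
  calc (S * T * S - T * S * T) * x
      = S * T * (S * x) - T * S * (T * x) := by noncomm_ring
    _ = S * T * (y * S + 1) - T * S * (x * T) := by rw [h₁, h₃]
    _ = S * (T * y) * S + S * T - T * (S * x) * T := by noncomm_ring
    _ = S * (z * T + 1) * S + S * T - T * (y * S + 1) * T := by rw [h₁, h₂]
    _ = (S * z) * T * S + S * S + S * T - (T * y) * S * T - T * T := by noncomm_ring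
    _ = _ := by rw [h₂, h₄, hS, hT]; noncomm_ring

lemma braid_mul_second (h₁ : S * y = x * S - 1) (h₂ : T * y = z * T + 1) (h₃ : T * x = x * T)
    (h₄ : S * z = z * S) (h₅ : S * x = y * S + 1) (h₆ : T * z = y * T - 1) :
    (S * T * S - T * S * T) * y = y * (S * T * S - T * S * T) := by
  calc (S * T * S - T * S * T) * y
      = S * T * (S * y) - T * S * (T * y) := by noncomm_ring
    _ = S * (T * x) * S - S * T - T * (S * z) * T - T * S := by rw [h₁, h₂]; noncomm_ring
    _ = (S * x) * T * S - S * T - (T * z) * S * T - T * S := by rw [h₃, h₄]; noncomm_ring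
    _ = _ := by rw [h₅, h₆]; noncomm_ring

lemma braid_mul_third (hS : S * S = 1) (hT : T * T = 1) (h₁ : S * z = z * S)
    (h₂ : T * z = y * T - 1) (h₃ : S * y = x * S - 1) (h₄ : T * x = x * T) :
    (S * T * S - T * S * T) * z = x * (S * T * S - T * S * T) := by
  calc (S * T * S - T * S * T) * z
      = S * T * (S * z) - T * S * (T * z) := by noncomm_ring
    _ = S * T * (z * S) - T * S * (y * T - 1) := by rw [h₁, h₂]
    _ = S * (T * z) * S - T * (S * y) * T + T * S := by noncomm_ring
    _ = S * (y * T - 1) * S - T * (x * S - 1) * T + T * S := by rw [h₂, h₃]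
    _ = (S * y) * T * S - S * S - (T * x) * S * T + T * T + T * S := by noncomm_ring
    _ = _ := by rw [h₃, h₄, hS, hT]; noncomm_ring

lemma braid_mul_other (h₁ : S * x = x * S) (h₂ : T * x = x * T) :
    (S * T * S - T * S * T) * x = x * (S * T * S - T * S * T) := by
  have h : Commute (S * T * S - T * S * T) x :=
    Commute.sub_left ((Commute.mul_left h₁ h₂).mul_left h₁) ((Commute.mul_left h₂ h₁).mul_left h₂)
  exact h

end TwistedCommutation

section RegularModule

/-! ### The right regular module of the degenerate affine Hecke algebra -/

universe u

variable (k : Type u) [CommRing k] (r : ℕ)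

/-- The space of functions from the symmetric group to polynomials.  Its element
`Pi.single w p` stands for the element `w p` of `AH_r`. -/
abbrev RegMod : Type u := Equiv.Perm (Fin r) → MvPolynomial (Fin r) k

variable {r}

/-- The right action of `x_a`. -/
def regX (a : Fin r) : Module.End k (RegMod k r) :=
  LinearMap.pi fun w => LinearMap.mulLeft k (X a) ∘ₗ LinearMap.proj w

/-- The right action of the transposition `s = (a  b)`, modelled on the identity
`w p s = (w s) (s p) + w (divDiff a b p)`. -/
def regS (a b : Fin r) : Module.End k (RegMod k r) :=
  LinearMap.pi fun w =>
    (rename (Equiv.swap a b)).toLinearMap ∘ₗ LinearMap.proj (w * Equiv.swap a b)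
      + divDiff a b ∘ₗ LinearMap.proj w

variable {k}

@[simp] lemma regX_apply (a : Fin r) (F : RegMod k r) (w) : regX k a F w = X a * F w := rfl

@[simp] lemma regS_apply (a b : Fin r) (F : RegMod k r) (w) :
    regS k a b F w = rename (Equiv.swap a b) (F (w * Equiv.swap a b)) + divDiff a b (F w) := rfl

lemma regS_single_one (a b : Fin r) (w : Equiv.Perm (Fin r)) :
    regS k a b (Pi.single w 1) = Pi.single (w * Equiv.swap a b) 1 := by
  funext v
  have h1 : divDiff a b (1 : MvPolynomial (Fin r) k) = 0 := by
    rw [← C_1, divDiff_C]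
  have h2 : divDiff a b ((Pi.single w 1 : RegMod k r) v) = 0 := by
    by_cases hv : v = w
    · subst hv; simp [h1]
    · simp [hv]
  rw [regS_apply, h2, add_zero]
  by_cases hv : v = w * Equiv.swap a b
  · subst hv
    simp [mul_assoc]
  · rw [Pi.single_eq_of_ne hv, Pi.single_eq_of_ne, map_zero]
    rintro rfl
    exact hv (by simp [mul_assoc])

/-- The defining commutation relation of `AH_r`, in the order of composition of operators. -/
lemma regS_comp_regX {a b : Fin r} (hab : a ≠ b) (c : Fin r) :
    regS k a b * regX k c = regX k (Equiv.swap a b c) * regS k a b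
      + (if c = a then 1 else if c = b then -1 else 0) := by
  refine LinearMap.ext fun F => funext fun w => ?_
  have : regS k a b (regX k c F) w = X (Equiv.swap a b c) * regS k a b F w
      + (if c = a then 1 else if c = b then -1 else 0) * F w := by
    rw [regS_apply, regX_apply, regX_apply, regS_apply, mul_comm (X c) (F w), divDiff_mul hab,
      divDiff_X, map_mul, rename_X]
    ring
  rw [Module.End.mul_apply, this]
  split_ifs <;> simp

lemma regX_comm (a b : Fin r) : regX k a * regX k b = regX k b * regX k a := by
  refine LinearMap.ext fun F => funext fun w => ?_
  simp only [Module.End.mul_apply, regX_apply]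
  ring

/-- An operator commuting with multiplication by the variables up to a permutation of them is
determined by its values on the group elements. -/
lemma reg_ext (σ : Fin r → Fin r) {D : Module.End k (RegMod k r)}
    (hX : ∀ a, D * regX k a = regX k (σ a) * D) (h1 : ∀ w, D (Pi.single w 1) = 0) : D = 0 := by
  refine LinearMap.pi_ext' fun w => LinearMap.ext fun p => ?_
  simp only [LinearMap.comp_apply, LinearMap.coe_single, LinearMap.zero_apply]
  induction p using MvPolynomial.induction_on with
  | C c =>
    have : (Pi.single w (C c) : RegMod k r) = c • Pi.single w 1 := by
      rw [← Pi.single_smul, smul_eq_C_mul, mul_one]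
    rw [this, map_smul, h1, smul_zero]
  | add p q hp hq => rw [Pi.single_add, map_add, hp, hq, add_zero]
  | mul_X p a hp =>
    have : (Pi.single w (p * X a) : RegMod k r) = regX k a (Pi.single w p) := by
      funext v
      rw [regX_apply]
      by_cases hv : v = w
      · subst hv; simp [mul_comm]
      · simp [hv]
    rw [this, ← Module.End.mul_apply, hX, Module.End.mul_apply, hp, map_zero]

lemma regS_comp_regX_left {a b : Fin r} (hab : a ≠ b) :
    regS k a b * regX k a = regX k b * regS k a b + 1 := by
  rw [regS_comp_regX hab, Equiv.swap_apply_left, if_pos rfl]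

lemma regS_comp_regX_right {a b : Fin r} (hab : a ≠ b) :
    regS k a b * regX k b = regX k a * regS k a b - 1 := by
  rw [regS_comp_regX hab, Equiv.swap_apply_right, if_neg hab.symm, if_pos rfl, sub_eq_add_neg]

lemma regS_comp_regX_of_ne {a b c : Fin r} (hab : a ≠ b) (hca : c ≠ a) (hcb : c ≠ b) :
    regS k a b * regX k c = regX k c * regS k a b := by
  rw [regS_comp_regX hab, Equiv.swap_apply_of_ne_of_ne hca hcb, if_neg hca, if_neg hcb, add_zero]

lemma regS_sq {a b : Fin r} (hab : a ≠ b) : regS k a b * regS k a b = 1 := by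
  rw [← sub_eq_zero]
  refine reg_ext id (fun c => ?_) fun w => ?_
  · rw [sub_mul, mul_sub, one_mul, mul_one, id]
    congr 1
    refine sq_mul_comm (regS_comp_regX hab c) ?_ (commute_ite_neg_one _ _ _)
    rw [regS_comp_regX hab, Equiv.swap_apply_self]
    by_cases hca : c = a
    · subst hca
      simp [hab.symm, sub_eq_add_neg]
    · by_cases hcb : c = b
      · subst hcb
        simp [hca]
      · simp [hca, hcb, Equiv.swap_apply_of_ne_of_ne hca hcb]
  · rw [LinearMap.sub_apply, Module.End.mul_apply, regS_single_one, regS_single_one, mul_assoc,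
      Equiv.swap_mul_self, mul_one, Module.End.one_apply, sub_self]

lemma regS_comm {a b c d : Fin r} (hab : a ≠ b) (hcd : c ≠ d) (hac : a ≠ c) (had : a ≠ d)
    (hbc : b ≠ c) (hbd : b ≠ d) : regS k a b * regS k c d = regS k c d * regS k a b := by
  have hs : Equiv.swap a b * Equiv.swap c d = Equiv.swap c d * Equiv.swap a b :=
    (Equiv.Perm.disjoint_iff_disjoint_support.2 (by
      rw [Equiv.Perm.support_swap hab, Equiv.Perm.support_swap hcd]
      simp [hac, had, hbc, hbd, eq_comm])).commute.eq
  rw [← sub_eq_zero]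
  refine reg_ext (fun e => Equiv.swap a b (Equiv.swap c d e)) (fun e => ?_) fun w => ?_
  · have hs' : Equiv.swap a b (Equiv.swap c d e) = Equiv.swap c d (Equiv.swap a b e) :=
      Equiv.congr_fun hs e
    have ha : Equiv.swap c d e = a ↔ e = a := by
      rw [Equiv.swap_apply_eq_iff, Equiv.swap_apply_of_ne_of_ne hac had]
    have hb : Equiv.swap c d e = b ↔ e = b := by
      rw [Equiv.swap_apply_eq_iff, Equiv.swap_apply_of_ne_of_ne hbc hbd]
    have hc : Equiv.swap a b e = c ↔ e = c := by
      rw [Equiv.swap_apply_eq_iff, Equiv.swap_apply_of_ne_of_ne hac.symm hbc.symm]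
    have hd : Equiv.swap a b e = d ↔ e = d := by
      rw [Equiv.swap_apply_eq_iff, Equiv.swap_apply_of_ne_of_ne had.symm hbd.symm]
    have h₂ := regS_comp_regX (k := k) hab (Equiv.swap c d e)
    have h₄ := regS_comp_regX (k := k) hcd (Equiv.swap a b e)
    simp only [ha, hb] at h₂
    simp only [hc, hd] at h₄
    rw [← hs'] at h₄
    refine comm_mul_twist (regS_comp_regX hcd e) h₂ (regS_comp_regX hab e) h₄
      (commute_ite_neg_one _ _ _) (commute_ite_neg_one _ _ _)
  · simp only [LinearMap.sub_apply, Module.End.mul_apply, regS_single_one, mul_assoc, hs, sub_self]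

lemma regS_braid {a b c : Fin r} (hab : a ≠ b) (hbc : b ≠ c) (hac : a ≠ c) :
    regS k a b * regS k b c * regS k a b = regS k b c * regS k a b * regS k b c := by
  have hs : Equiv.swap a b * (Equiv.swap b c * Equiv.swap a b)
      = Equiv.swap b c * (Equiv.swap a b * Equiv.swap b c) := by
    ext x
    simp only [Equiv.Perm.mul_apply, Equiv.swap_apply_def]
    split_ifs <;> simp_all
  rw [← sub_eq_zero]
  refine reg_ext (Equiv.swap a c) (fun e => ?_) fun w => ?_
  · have Sa := regS_comp_regX_left (k := k) hab
    have Sb := regS_comp_regX_right (k := k) hab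
    have Sc := regS_comp_regX_of_ne (k := k) hab hac.symm hbc.symm
    have Ta := regS_comp_regX_of_ne (k := k) hbc hab hac
    have Tb := regS_comp_regX_left (k := k) hbc
    have Tc := regS_comp_regX_right (k := k) hbc
    by_cases hea : e = a
    · subst hea
      rw [Equiv.swap_apply_left]
      exact braid_mul_first (regS_sq hab) (regS_sq hbc) Sa Tb Ta Sc
    by_cases hec : e = c
    · subst hec
      rw [Equiv.swap_apply_right]
      exact braid_mul_third (regS_sq hab) (regS_sq hbc) Sc Tc Sb Ta
    rw [Equiv.swap_apply_of_ne_of_ne hea hec]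
    by_cases heb : e = b
    · subst heb
      exact braid_mul_second Sb Tb Ta Sc Sa Tc
    · exact braid_mul_other (regS_comp_regX_of_ne hab hea heb) (regS_comp_regX_of_ne hbc heb hec)
  · simp only [LinearMap.sub_apply, Module.End.mul_apply, regS_single_one, mul_assoc, hs, sub_self]

variable (k r)

/-- The images of the generators of `AH_r`.  The action is on the right, so the target is the
opposite of the endomorphism algebra. -/
def regGen : AHGen r → (Module.End k (RegMod k r))ᵐᵒᵖ
  | .x i hi => MulOpposite.op (regX k ⟨i, hi⟩)
  | .s i hi => MulOpposite.op (regS k ⟨i, by omega⟩ ⟨i + 1, hi⟩)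

/-- The right action of `AH_r` on `RegMod k r`. -/
def regRep : AH k r →ₐ[k] (Module.End k (RegMod k r))ᵐᵒᵖ :=
  RingQuot.liftAlgHom k ⟨FreeAlgebra.lift k (regGen k r), by
    intro a b h
    have hne : ∀ (i : ℕ) (hi : i + 1 < r), (⟨i, by omega⟩ : Fin r) ≠ ⟨i + 1, hi⟩ := by
      intro i hi; simp
    cases h with
    | x_comm i j hi hj =>
      simp only [map_mul, FreeAlgebra.lift_ι_apply, regGen, ← MulOpposite.op_mul, regX_comm]
    | s_sq i hi =>
      simp only [map_mul, FreeAlgebra.lift_ι_apply, regGen, ← MulOpposite.op_mul,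
        regS_sq (hne i hi), map_one, MulOpposite.op_one]
    | s_comm i j hi hj hij =>
      simp only [map_mul, FreeAlgebra.lift_ι_apply, regGen, ← MulOpposite.op_mul]
      rw [regS_comm (hne i hi) (hne j hj)] <;> simp <;> omega
    | s_braid i hi hi' =>
      simp only [map_mul, FreeAlgebra.lift_ι_apply, regGen, ← MulOpposite.op_mul, ← mul_assoc]
      rw [regS_braid (hne i hi) (hne (i + 1) hi') (by simp; omega)]
    | s_x i hi hi' =>
      simp only [map_mul, FreeAlgebra.lift_ι_apply, regGen, ← MulOpposite.op_mul, map_add, map_one]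
      have := regS_comp_regX (k := k) (hne i hi') ⟨i + 1, hi'⟩
      simp only [Equiv.swap_apply_right, (hne i hi').symm, if_true, if_false] at this
      rw [this]
      simp
    | x_s i hi hi' =>
      simp only [map_mul, FreeAlgebra.lift_ι_apply, regGen, ← MulOpposite.op_mul, map_add, map_one]
      have := regS_comp_regX (k := k) (hne i hi') ⟨i, hi⟩
      simp only [Equiv.swap_apply_left, if_true] at this
      rw [this]
      simp
    | x_s_comm i j hi hj h₁ h₂ =>
      have hx : (⟨i, hi⟩ : Fin r) ≠ ⟨j, by omega⟩ := by simpa using h₁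
      have hy : (⟨i, hi⟩ : Fin r) ≠ ⟨j + 1, hj⟩ := by simpa using h₂
      have := regS_comp_regX (k := k) (hne j hj) ⟨i, hi⟩
      simp only [Equiv.swap_apply_of_ne_of_ne hx hy, hx, hy, if_false, add_zero] at this
      simp only [map_mul, FreeAlgebra.lift_ι_apply, regGen, ← MulOpposite.op_mul, this]⟩

lemma regRep_x (i : Fin r) : regRep k r (AH.x k i) = MulOpposite.op (regX k i) := by
  have : regRep k r (AH.x k i) = FreeAlgebra.lift k (regGen k r) (fx k i i.isLt) :=
    RingQuot.liftAlgHom_mkAlgHom_apply ..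
  rw [this, FreeAlgebra.lift_ι_apply]; rfl

lemma regRep_s (i : ℕ) (hi : i + 1 < r) :
    regRep k r (AH.s k i hi) = MulOpposite.op (regS k ⟨i, by omega⟩ ⟨i + 1, hi⟩) := by
  have : regRep k r (AH.s k i hi) = FreeAlgebra.lift k (regGen k r) (fs k i hi) :=
    RingQuot.liftAlgHom_mkAlgHom_apply ..
  rw [this, FreeAlgebra.lift_ι_apply]; rfl

end RegularModule

section Filtration

/-! ### The degree filtration -/

universe u

/-- Induction on permutations by left multiplication with basic transpositions. -/
lemma perm_induction {r : ℕ} {P : Equiv.Perm (Fin r) → Prop} (one : P 1)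
    (mul : ∀ i (hi : i + 1 < r) w, P w → P (basicSwap i hi * w)) (w : Equiv.Perm (Fin r)) :
    P w := by
  cases r with
  | zero => rwa [Subsingleton.elim w 1]
  | succ n =>
    have hw : w ∈ Submonoid.closure
        (Set.range fun i : Fin n => Equiv.swap i.castSucc i.succ) := by
      rw [Equiv.Perm.mclosure_swap_castSucc_succ]; trivial
    induction hw using Submonoid.closure_induction_left with
    | one => exact one
    | mul_left x hx y hy ih =>
      obtain ⟨i, rfl⟩ := hx
      exact mul i (by omega) y ih

variable (k : Type u) [CommRing k] (r : ℕ)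

variable {r} in
lemma AH.induction {P : AH k r → Prop} (scalar : ∀ c : k, P (algebraMap k _ c))
    (x : ∀ i, P (AH.x k i)) (s : ∀ i hi, P (AH.s k i hi))
    (mul : ∀ a b, P a → P b → P (a * b)) (add : ∀ a b, P a → P b → P (a + b)) (a : AH k r) :
    P a := by
  obtain ⟨b, rfl⟩ := RingQuot.mkAlgHom_surjective k (AHRel k r) a
  change P (AH.mk k r b)
  induction b using FreeAlgebra.induction with
  | grade0 c => rw [AlgHom.commutes]; exact scalar c
  | grade1 g =>
    cases g with
    | x i hi => exact x ⟨i, hi⟩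
    | s i hi => exact s i hi
  | mul a b ha hb => rw [map_mul]; exact mul _ _ ha hb
  | add a b ha hb => rw [map_add]; exact add _ _ ha hb

lemma basicSwap_ne {r i : ℕ} (hi : i + 1 < r) : (⟨i, by omega⟩ : Fin r) ≠ ⟨i + 1, hi⟩ := by
  simp

variable {r}

lemma AH.x_mul_s (c : Fin r) (i : ℕ) (hi : i + 1 < r) :
    AH.x k c * AH.s k i hi = AH.s k i hi * AH.x k (basicSwap i hi c)
      + AH.ofPoly k r (divDiff ⟨i, by omega⟩ ⟨i + 1, hi⟩ (X c)) := by
  rw [divDiff_X]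
  by_cases h₁ : c = ⟨i, by omega⟩
  · subst h₁
    have h := AH.mk_rel k (AHRel.x_s i (by omega) hi)
    simp only [map_mul, map_add, map_one] at h
    rw [basicSwap, Equiv.swap_apply_left, if_pos rfl, map_one]
    exact h
  by_cases h₂ : c = ⟨i + 1, hi⟩
  · subst h₂
    have h := AH.mk_rel k (AHRel.s_x i (by omega) hi)
    simp only [map_mul, map_add, map_one] at h
    rw [basicSwap, Equiv.swap_apply_right, if_neg h₁, if_pos rfl, map_neg, map_one,
      ← sub_eq_add_neg, eq_sub_iff_add_eq]
    exact h.symm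
  · have h := AH.mk_rel k (AHRel.x_s_comm (c : ℕ) i c.isLt hi
      (fun h => h₁ (Fin.ext h)) (fun h => h₂ (Fin.ext h)))
    simp only [map_mul] at h
    rw [basicSwap, Equiv.swap_apply_of_ne_of_ne h₁ h₂, if_neg h₁, if_neg h₂, map_zero, add_zero]
    exact h

/-- The commutation rule `p s = s (s p) + divDiff p`. -/
lemma AH.ofPoly_mul_s (p : MvPolynomial (Fin r) k) (i : ℕ) (hi : i + 1 < r) :
    AH.ofPoly k r p * AH.s k i hi = AH.s k i hi * AH.ofPoly k r (rename (basicSwap i hi) p)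
      + AH.ofPoly k r (divDiff ⟨i, by omega⟩ ⟨i + 1, hi⟩ p) := by
  induction p using MvPolynomial.induction_on with
  | C c =>
    rw [divDiff_C, rename_C, map_zero, add_zero, ← MvPolynomial.algebraMap_eq, AlgHom.commutes]
    exact (Algebra.commutes c _)
  | add p q hp hq =>
    simp only [map_add, add_mul, mul_add, hp, hq]
    abel
  | mul_X p c hp =>
    rw [divDiff_mul (basicSwap_ne hi), map_mul, AH.ofPoly_X, mul_assoc, AH.x_mul_s, mul_add,
      ← mul_assoc, hp, map_mul, rename_X, map_add, map_mul, map_mul, map_mul, rename_X,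
      AH.ofPoly_X, AH.ofPoly_X]
    simp only [add_mul, mul_assoc, basicSwap]
    abel

lemma AH.ofPoly_commute_of_isSymmetric {f : MvPolynomial (Fin r) k} (hf : f.IsSymmetric)
    (a : AH k r) : AH.ofPoly k r f * a = a * AH.ofPoly k r f := by
  induction a using AH.induction with
  | scalar c => exact (Algebra.commutes c _).symm
  | x i => rw [← AH.ofPoly_X, ← map_mul, mul_comm, map_mul]
  | s i hi =>
    rw [AH.ofPoly_mul_s, hf, divDiff_eq_zero (basicSwap_ne hi) (hf _), map_zero, add_zero]
  | mul a b ha hb => rw [← mul_assoc, ha, mul_assoc, hb, mul_assoc]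
  | add a b ha hb => rw [mul_add, ha, hb, add_mul]

variable (r) in
/-- The span of the elements `w p` with `w` in the symmetric group and `p` a polynomial of degree
less than `d`. -/
def AH.filt (d : ℕ) : Submodule k (AH k r) :=
  Submodule.span k {a | ∃ w, ∃ p ∈ lowDeg k (Fin r) d, a = AH.permHom k r w * AH.ofPoly k r p}

variable {k}

lemma AH.mul_mem_filt {d : ℕ} (w : Equiv.Perm (Fin r)) {p : MvPolynomial (Fin r) k}
    (hp : p ∈ lowDeg k (Fin r) d) : AH.permHom k r w * AH.ofPoly k r p ∈ AH.filt k r d :=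
  Submodule.subset_span ⟨w, p, hp, rfl⟩

/-- It suffices to check an inclusion of the filtered piece on the spanning elements `w p`. -/
lemma AH.filt_le_of {d : ℕ} {U : Submodule k (AH k r)}
    (h : ∀ w, ∀ p ∈ lowDeg k (Fin r) d, AH.permHom k r w * AH.ofPoly k r p ∈ U) :
    AH.filt k r d ≤ U := by
  rw [AH.filt, Submodule.span_le]
  rintro _ ⟨w, p, hp, rfl⟩
  exact h w p hp

lemma AH.filt_mono {d e : ℕ} (h : d ≤ e) : AH.filt k r d ≤ AH.filt k r e :=
  AH.filt_le_of fun w _ hp => AH.mul_mem_filt w (lowDeg_mono h hp)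

lemma AH.filt_zero {a : AH k r} (ha : a ∈ AH.filt k r 0) : a = 0 := by
  have : AH.filt k r 0 ≤ ⊥ := AH.filt_le_of fun w p hp => by
    rw [eq_zero_of_mem_lowDeg_zero hp]; simp
  exact (Submodule.mem_bot k).1 (this ha)

lemma AH.ofPoly_mem_filt {d : ℕ} {p : MvPolynomial (Fin r) k} (hp : p ∈ lowDeg k (Fin r) d) :
    AH.ofPoly k r p ∈ AH.filt k r d := by
  simpa using AH.mul_mem_filt 1 hp

lemma AH.perm_mul_mem_filt {d : ℕ} (w : Equiv.Perm (Fin r)) {a : AH k r}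
    (ha : a ∈ AH.filt k r d) : AH.permHom k r w * a ∈ AH.filt k r d := by
  have : AH.filt k r d ≤ (AH.filt k r d).comap (LinearMap.mulLeft k (AH.permHom k r w)) :=
    AH.filt_le_of fun v p hp => by
      simpa [← mul_assoc, ← map_mul] using AH.mul_mem_filt (w * v) hp
  exact this ha

lemma AH.mul_ofPoly_mem_filt {d e : ℕ} {a : AH k r} (ha : a ∈ AH.filt k r d)
    {p : MvPolynomial (Fin r) k} (hp : p ∈ lowDeg k (Fin r) (e + 1)) :
    a * AH.ofPoly k r p ∈ AH.filt k r (d + e) := by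
  have : AH.filt k r d ≤ (AH.filt k r (d + e)).comap (LinearMap.mulRight k (AH.ofPoly k r p)) :=
    AH.filt_le_of fun v q hq => by
      simpa [mul_assoc, ← map_mul] using AH.mul_mem_filt v (mul_mem_lowDeg hq hp)
  exact this ha

/-- Moving a group element to the left past a polynomial permutes the variables, up to terms of
lower degree. -/
lemma AH.ofPoly_mul_perm_sub_mem {d : ℕ} (w : Equiv.Perm (Fin r)) {p : MvPolynomial (Fin r) k}
    (hp : p ∈ lowDeg k (Fin r) (d + 1)) :
    AH.ofPoly k r p * AH.permHom k r w - AH.permHom k r w * AH.ofPoly k r (rename ⇑w⁻¹ p)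
      ∈ AH.filt k r d := by
  induction w using perm_induction generalizing d p with
  | one =>
    have : rename (⇑(1 : Equiv.Perm (Fin r))⁻¹) p = p := by
      rw [inv_one, Equiv.Perm.coe_one, rename_id_apply]
    rw [map_one, mul_one, one_mul, this, sub_self]
    exact zero_mem _
  | mul i hi w ih =>
    have hlow : ∀ {e : ℕ} {q : MvPolynomial (Fin r) k}, q ∈ lowDeg k (Fin r) e →
        AH.ofPoly k r q * AH.permHom k r w ∈ AH.filt k r e := by
      intro e q hq
      cases e with
      | zero => rw [eq_zero_of_mem_lowDeg_zero hq]; simp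
      | succ e =>
        have h1 := AH.filt_mono (Nat.le_succ e) (ih hq)
        have h2 := AH.mul_mem_filt w (rename_mem_lowDeg w⁻¹ hq)
        simpa using add_mem h1 h2
    have h1 := AH.perm_mul_mem_filt (basicSwap i hi) (ih (rename_mem_lowDeg (basicSwap i hi) hp))
    have h2 := hlow (divDiff_mem_lowDeg (basicSwap_ne hi) hp)
    have h3 := add_mem h1 h2
    have hr : rename ⇑(basicSwap i hi * w)⁻¹ p = rename ⇑w⁻¹ (rename ⇑(basicSwap i hi) p) := by
      rw [rename_rename, mul_inv_rev, Equiv.Perm.coe_mul]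
      have : (basicSwap i hi)⁻¹ = basicSwap i hi := Equiv.swap_inv _ _
      rw [this]
    have heq : AH.ofPoly k r p * AH.permHom k r (basicSwap i hi * w)
        = AH.permHom k r (basicSwap i hi) *
            (AH.ofPoly k r (rename ⇑(basicSwap i hi) p) * AH.permHom k r w)
          + AH.ofPoly k r (divDiff ⟨i, by omega⟩ ⟨i + 1, hi⟩ p) * AH.permHom k r w := by
      rw [map_mul, ← mul_assoc, AH.permHom_basicSwap, AH.ofPoly_mul_s, add_mul, mul_assoc]
    rw [heq, hr, map_mul]
    convert h3 using 1
    noncomm_ring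

lemma AH.ofPoly_mul_perm_mem_filt {d : ℕ} (w : Equiv.Perm (Fin r)) {p : MvPolynomial (Fin r) k}
    (hp : p ∈ lowDeg k (Fin r) d) : AH.ofPoly k r p * AH.permHom k r w ∈ AH.filt k r d := by
  cases d with
  | zero => rw [eq_zero_of_mem_lowDeg_zero hp]; simp
  | succ e =>
    have h1 := AH.filt_mono (Nat.le_succ e) (AH.ofPoly_mul_perm_sub_mem w hp)
    have h2 := AH.mul_mem_filt w (rename_mem_lowDeg w⁻¹ hp)
    simpa using add_mem h1 h2

lemma AH.mul_mem_filt_add {d e : ℕ} {a b : AH k r} (ha : a ∈ AH.filt k r d)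
    (hb : b ∈ AH.filt k r (e + 1)) : a * b ∈ AH.filt k r (d + e) := by
  have : AH.filt k r (e + 1) ≤ (AH.filt k r (d + e)).comap (LinearMap.mulLeft k a) :=
    AH.filt_le_of fun w p hp => by
      have h : AH.filt k r d ≤
          (AH.filt k r d).comap (LinearMap.mulRight k (AH.permHom k r w)) :=
        AH.filt_le_of fun v q hq => by
          simpa [mul_assoc] using AH.perm_mul_mem_filt v (AH.ofPoly_mul_perm_mem_filt w hq)
      simpa [mul_assoc] using AH.mul_ofPoly_mem_filt (h ha) hp
  exact this hb

lemma AH.mul_mem_filt_add' {d e : ℕ} {a b : AH k r} (ha : a ∈ AH.filt k r (d + 1))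
    (hb : b ∈ AH.filt k r e) : a * b ∈ AH.filt k r (d + e) := by
  cases e with
  | zero => rw [AH.filt_zero hb, mul_zero]; exact zero_mem _
  | succ e =>
    have := AH.mul_mem_filt_add ha hb
    rwa [show d + 1 + e = d + (e + 1) by omega] at this

lemma AH.perm_mem_filt (w : Equiv.Perm (Fin r)) : AH.permHom k r w ∈ AH.filt k r 1 := by
  have : (1 : MvPolynomial (Fin r) k) ∈ lowDeg k (Fin r) 1 :=
    mem_lowDeg_of_isHomogeneous (isHomogeneous_one _ _)
  simpa using AH.mul_mem_filt w this

lemma AH.exists_mem_filt (a : AH k r) : ∃ d, a ∈ AH.filt k r (d + 1) := by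
  induction a using AH.induction with
  | scalar c =>
    refine ⟨0, ?_⟩
    rw [Algebra.algebraMap_eq_smul_one]
    exact Submodule.smul_mem _ _ (by simpa using AH.perm_mem_filt (k := k) (1 : Equiv.Perm (Fin r)))
  | x i =>
    refine ⟨1, ?_⟩
    rw [← AH.ofPoly_X]
    exact AH.ofPoly_mem_filt (mem_lowDeg_of_isHomogeneous (isHomogeneous_X k i))
  | s i hi =>
    refine ⟨0, ?_⟩
    rw [← AH.permHom_basicSwap]
    exact AH.perm_mem_filt _
  | mul a b ha hb =>
    obtain ⟨d, hd⟩ := ha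
    obtain ⟨e, he⟩ := hb
    exact ⟨d + e, by simpa [add_right_comm] using AH.mul_mem_filt_add hd he⟩
  | add a b ha hb =>
    obtain ⟨d, hd⟩ := ha
    obtain ⟨e, he⟩ := hb
    exact ⟨d + e, add_mem (AH.filt_mono (by omega) hd) (AH.filt_mono (by omega) he)⟩

end Filtration

section RegularModuleAction

/-! ### The symmetric group and the polynomials acting on the regular module -/

universe u

variable {k : Type u} [CommRing k] {r : ℕ}

lemma regRep_permHom_single (w v : Equiv.Perm (Fin r)) :
    (regRep k r (AH.permHom k r w)).unop (Pi.single v 1) = Pi.single (v * w) 1 := by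
  induction w using perm_induction generalizing v with
  | one => simp
  | mul i hi w ih =>
    rw [map_mul, map_mul, MulOpposite.unop_mul, Module.End.mul_apply, AH.permHom_basicSwap,
      regRep_s, MulOpposite.unop_op, regS_single_one, ih, mul_assoc]
    rfl

lemma regRep_ofPoly (p : MvPolynomial (Fin r) k) (F : RegMod k r) (w : Equiv.Perm (Fin r)) :
    (regRep k r (AH.ofPoly k r p)).unop F w = p * F w := by
  induction p using MvPolynomial.induction_on generalizing F with
  | C c =>
    rw [← MvPolynomial.algebraMap_eq, AlgHom.commutes, AlgHom.commutes, MvPolynomial.algebraMap_eq,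
      ← smul_eq_C_mul]
    rfl
  | add p q hp hq =>
    rw [map_add, map_add, MulOpposite.unop_add, LinearMap.add_apply, Pi.add_apply, hp, hq, add_mul]
  | mul_X p a hp =>
    rw [map_mul, map_mul, MulOpposite.unop_mul, Module.End.mul_apply, AH.ofPoly_X, regRep_x,
      MulOpposite.unop_op, regX_apply, hp]
    ring

end RegularModuleAction

section UniversalProperty

/-! ### Maps out of induced modules -/

universe u

variable {k : Type u} [CommRing k] {R S : Type u} [Ring R] [Algebra k R] [Ring S] [Algebra k S]
variable (φ : R →ₐ[k] S) {V : Type u} [AddCommGroup V] [Module k V] [Module Rᵐᵒᵖ V]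

/-- The linear map on `V ⊗_R S` given by a balanced bilinear map. -/
def indLift {W : Type*} [AddCommGroup W] [Module k W] (B : V →ₗ[k] S →ₗ[k] W)
    (hB : ∀ v a s, B (MulOpposite.op a • v) s = B v (φ a * s)) : Ind φ V →ₗ[k] W :=
  (indRel φ V).liftQ (TensorProduct.lift B) (by
    rw [indRel, Submodule.span_le]
    rintro _ ⟨v, a, s, rfl⟩
    simp [hB])

lemma indLift_tmul {W : Type*} [AddCommGroup W] [Module k W] (B : V →ₗ[k] S →ₗ[k] W)
    (hB : ∀ v a s, B (MulOpposite.op a • v) s = B v (φ a * s)) (v : V) (s : S) :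
    indLift φ B hB (indTmul φ v s) = B v s := by
  rfl

/-- The bilinear map `(v, s) ↦ v ⊗ s`. -/
def indTmulₗ : V →ₗ[k] S →ₗ[k] Ind φ V := (TensorProduct.mk k V S).compr₂ (indMk φ V)

lemma indTmulₗ_apply (v : V) (s : S) : indTmulₗ φ v s = indTmul φ v s := rfl

end UniversalProperty

section InducedPermutationModule

/-! ### A basis of the induced permutation module over the polynomials -/

universe u

variable {k : Type u} [CommRing k] {r n : ℕ} (lam : Fin n → ℕ)

lemma AH.ofGroupAlg_single (w : Equiv.Perm (Fin r)) (c : k) :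
    AH.ofGroupAlg k r (MonoidAlgebra.single w c) = c • AH.permHom k r w := by
  simp [AH.ofGroupAlg]

lemma op_smul_genTmul (a s : AH k r) :
    MulOpposite.op s • genTmul k r lam a = genTmul k r lam (a * s) := rfl

variable (k r) in
/-- The map `a ↦ m_λ ⊗ a`. -/
def genTmulₗ : AH k r →ₗ[k] IndPermMod k r lam :=
  indTmulₗ (AH.ofGroupAlg k r) (permModGen k r lam)

lemma genTmulₗ_apply (a : AH k r) : genTmulₗ k r lam a = genTmul k r lam a := rfl

variable (k) in
/-- The scalar underlying an element of the trivial module. -/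
def trivVal (G : Type) : TrivMod k G →ₗ[k] k := LinearMap.id

lemma op_smul_trivMod (G : Type) [Group G] (a : MonoidAlgebra k G) (c : TrivMod k G) :
    MulOpposite.op a • c = (augmentation k G a • c : TrivMod k G) := rfl

lemma op_single_smul_permModGen {u : Equiv.Perm (Fin r)} (hu : u ∈ youngSubgroup r lam) :
    MulOpposite.op (MonoidAlgebra.single u (1 : k)) • permModGen k r lam = permModGen k r lam := by
  have h := indTmul_balanced (youngIncl k r lam)
    (show TrivMod k (youngSubgroup r lam) from (1 : k)) (MonoidAlgebra.single ⟨u, hu⟩ 1) 1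
  have h1 : youngIncl k r lam (MonoidAlgebra.single ⟨u, hu⟩ 1) = MonoidAlgebra.single u 1 := by
    simp [youngIncl]
  have h2 : augmentation k (youngSubgroup r lam) (MonoidAlgebra.single ⟨u, hu⟩ 1) = 1 := by
    simp [augmentation]
  rw [h1, op_smul_trivMod, h2, one_smul, mul_one] at h
  rw [permModGen, op_smul_indTmul, one_mul]
  exact h.symm

lemma genTmul_perm_mul {u : Equiv.Perm (Fin r)} (hu : u ∈ youngSubgroup r lam) (a : AH k r) :
    genTmul k r lam (AH.permHom k r u * a) = genTmul k r lam a := by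
  have h := indTmul_balanced (AH.ofGroupAlg k r) (permModGen k r lam)
    (MonoidAlgebra.single u (1 : k)) a
  rw [op_single_smul_permModGen lam hu, AH.ofGroupAlg_single, one_smul] at h
  exact h.symm

lemma genTmul_surjective (x : IndPermMod k r lam) : ∃ a, genTmul k r lam a = x := by
  suffices h : LinearMap.range (genTmulₗ k r lam) = ⊤ from LinearMap.range_eq_top.1 h x
  have key : (LinearMap.range (genTmulₗ k r lam)).mkQ = 0 := by
    refine ind_hom_ext _ fun v s => ?_
    -- reduce to a pure tensor in the first factor
    have : (LinearMap.range (genTmulₗ k r lam)).mkQ ∘ₗ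
        (indTmulₗ (AH.ofGroupAlg k r)).flip s = 0 := by
      refine ind_hom_ext _ fun c b => ?_
      rw [LinearMap.comp_apply, LinearMap.zero_apply, LinearMap.flip_apply, Submodule.mkQ_apply,
        Submodule.Quotient.mk_eq_zero]
      have hc : indTmul (youngIncl k r lam) c b
          = trivVal k _ c • MulOpposite.op b • permModGen k r lam := by
        rw [permModGen, op_smul_indTmul, one_mul, ← indTmulₗ_apply, ← indTmulₗ_apply,
          ← LinearMap.smul_apply, ← map_smul]
        congr 2
        exact (mul_one (trivVal k _ c)).symm
      refine ⟨trivVal k _ c • (AH.ofGroupAlg k r b * s), ?_⟩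
      rw [hc, map_smul, map_smul, LinearMap.smul_apply]
      congr 1
      exact (indTmul_balanced (AH.ofGroupAlg k r) (permModGen k r lam) b s).symm
    exact LinearMap.congr_fun this v
  rw [← Submodule.ker_mkQ (LinearMap.range (genTmulₗ k r lam)), key, LinearMap.ker_zero]

/-- A linear map on `AH_r` that is invariant under left multiplication by `S_λ` factors through
`M(λ) ⊗ AH_r`. -/
lemma exists_lift {W : Type*} [AddCommGroup W] [Module k W] (ψ : AH k r →ₗ[k] W)
    (hψ : ∀ u ∈ youngSubgroup r lam, ∀ a, ψ (AH.permHom k r u * a) = ψ a) :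
    ∃ L : IndPermMod k r lam →ₗ[k] W, ∀ a, L (genTmul k r lam a) = ψ a := by
  -- the bilinear map `(c, b) ↦ (a ↦ c • ψ (b a))` on the trivial module and the group algebra
  let B₀ : MonoidAlgebra k (Equiv.Perm (Fin r)) →ₗ[k] AH k r →ₗ[k] W :=
    ((LinearMap.mul k (AH k r)).compr₂ ψ).comp (AH.ofGroupAlg k r).toLinearMap
  have hB₀ : ∀ b a, B₀ b a = ψ (AH.ofGroupAlg k r b * a) := fun _ _ => rfl
  let B₁ : TrivMod k (youngSubgroup r lam) →ₗ[k] MonoidAlgebra k (Equiv.Perm (Fin r)) →ₗ[k]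
      AH k r →ₗ[k] W := LinearMap.toSpanSingleton k _ B₀
  have hB₁ : ∀ c b a, B₁ c b a = trivVal k _ c • ψ (AH.ofGroupAlg k r b * a) :=
    fun _ _ _ => rfl
  have inv : ∀ (z : MonoidAlgebra k (youngSubgroup r lam)) (a : AH k r),
      ψ (AH.ofGroupAlg k r (youngIncl k r lam z) * a)
        = augmentation k (youngSubgroup r lam) z • ψ a := by
    intro z a
    induction z using MonoidAlgebra.induction_linear with
    | zero => simp
    | add f g hf hg => simp only [map_add, add_mul, hf, hg, add_smul]
    | single u c =>
      have h1 : youngIncl k r lam (MonoidAlgebra.single u c)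
          = MonoidAlgebra.single (u : Equiv.Perm (Fin r)) c := by
        simp [youngIncl]
      have h2 : augmentation k (youngSubgroup r lam) (MonoidAlgebra.single u c) = c := by
        simp [augmentation]
      rw [h1, h2, AH.ofGroupAlg_single, smul_mul_assoc, map_smul, hψ u u.2]
  let B : PermMod k r lam →ₗ[k] AH k r →ₗ[k] W := indLift (youngIncl k r lam) B₁ (by
    intro c z b
    refine LinearMap.ext fun a => ?_
    rw [hB₁, hB₁, map_mul (AH.ofGroupAlg k r), mul_assoc, inv, op_smul_trivMod, map_smul,
      smul_smul, smul_eq_mul, mul_comm])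
  have hB : ∀ c b a, B (indTmul (youngIncl k r lam) c b) a
      = trivVal k _ c • ψ (AH.ofGroupAlg k r b * a) := fun _ _ _ => rfl
  have hBal : ∀ v b s, B (MulOpposite.op b • v) s = B v (AH.ofGroupAlg k r b * s) := by
    intro v b s
    let e : Module.End k (PermMod k r lam) := indMulRight (youngIncl k r lam) _ b
    have h : (B.flip s) ∘ₗ e = B.flip (AH.ofGroupAlg k r b * s) := by
      refine ind_hom_ext _ fun c b' => ?_
      rw [LinearMap.comp_apply, LinearMap.flip_apply, LinearMap.flip_apply, indMulRight_tmul, hB,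
        hB, map_mul (AH.ofGroupAlg k r), mul_assoc]
    exact LinearMap.congr_fun h v
  refine ⟨indLift (AH.ofGroupAlg k r) B hBal, fun a => ?_⟩
  rw [genTmul, indLift_tmul, permModGen, hB, map_one, one_mul]
  exact one_smul _ _

/-- Endomorphisms of `M(λ) ⊗ AH_r` correspond to its `S_λ`-invariants. -/
lemma exists_endo (y : AH k r)
    (hy : ∀ u ∈ youngSubgroup r lam,
      genTmul k r lam (y * AH.permHom k r u) = genTmul k r lam y) :
    ∃ L : Module.End (AH k r)ᵐᵒᵖ (IndPermMod k r lam),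
      ∀ a, L (genTmul k r lam a) = genTmul k r lam (y * a) := by
  obtain ⟨L, hL⟩ := exists_lift lam (genTmulₗ k r lam ∘ₗ LinearMap.mulLeft k y) (by
    intro u hu a
    have h := congrArg (MulOpposite.op a • ·) (hy u hu)
    simp only [op_smul_genTmul] at h
    simpa only [LinearMap.comp_apply, LinearMap.mulLeft_apply, genTmulₗ_apply, mul_assoc] using h)
  refine ⟨{ toFun := L, map_add' := L.map_add, map_smul' := ?_ }, hL⟩
  intro s x
  obtain ⟨a, rfl⟩ := genTmul_surjective lam x
  change L (MulOpposite.op s.unop • genTmul k r lam a) = MulOpposite.op s.unop • _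
  rw [op_smul_genTmul, hL, hL]
  simp only [LinearMap.comp_apply, LinearMap.mulLeft_apply, genTmulₗ_apply, op_smul_genTmul,
    mul_assoc]

lemma endo_ext {L L' : Module.End (AH k r)ᵐᵒᵖ (IndPermMod k r lam)}
    (h : L (genTmul k r lam 1) = L' (genTmul k r lam 1)) : L = L' := by
  refine LinearMap.ext fun x => ?_
  obtain ⟨a, rfl⟩ := genTmul_surjective lam x
  rw [← one_mul a, ← op_smul_genTmul, map_smul, map_smul, h]

open Classical in
variable (k) in
/-- The indicator function of the Young subgroup. -/
def youngInd (w : Equiv.Perm (Fin r)) : k := if w ∈ youngSubgroup r lam then 1 else 0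

lemma youngInd_of_mem {w : Equiv.Perm (Fin r)} (h : w ∈ youngSubgroup r lam) :
    youngInd k lam w = 1 := if_pos h

lemma youngInd_of_not_mem {w : Equiv.Perm (Fin r)} (h : w ∉ youngSubgroup r lam) :
    youngInd k lam w = 0 := if_neg h

lemma youngInd_mul_right {u : Equiv.Perm (Fin r)} (hu : u ∈ youngSubgroup r lam)
    (w : Equiv.Perm (Fin r)) : youngInd k lam (w * u) = youngInd k lam w := by
  classical exact if_congr (Subgroup.mul_mem_cancel_right _ hu) rfl rfl

lemma regRep_permHom_youngInd (w : Equiv.Perm (Fin r)) :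
    (regRep k r (AH.permHom k r w)).unop (fun v => C (youngInd k lam v))
      = fun v => C (youngInd k lam (v * w⁻¹)) := by
  have h : (fun v => C (youngInd k lam v) : RegMod k r)
      = ∑ v, youngInd k lam v • Pi.single v 1 := by
    funext v
    simp [Finset.sum_apply, Pi.single_apply, smul_eq_C_mul]
  rw [h, map_sum]
  simp only [map_smul, regRep_permHom_single]
  funext v
  rw [Finset.sum_apply, Finset.sum_eq_single (v * w⁻¹)]
  · simp [smul_eq_C_mul]
  · intro u _ hu
    rw [Pi.smul_apply, Pi.single_eq_of_ne, smul_zero]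
    rintro rfl
    exact hu (by simp)
  · simp

/-- The coordinates of an element of `M(λ) ⊗ AH_r`: the coordinate of `m_λ ⊗ w p` at `v` is `p` if
`v` lies in the coset `S_λ w` and `0` otherwise. -/
lemma exists_coord : ∃ T : IndPermMod k r lam →ₗ[k] RegMod k r, ∀ w p v,
    T (genTmul k r lam (AH.permHom k r w * AH.ofPoly k r p)) v
      = youngInd k lam (v * w⁻¹) • p := by
  let ψ : AH k r →ₗ[k] RegMod k r :=
    { toFun := fun a => (regRep k r a).unop fun v => C (youngInd k lam v)
      map_add' := fun a b => by simp
      map_smul' := fun c a => by simp }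
  obtain ⟨T, hT⟩ := exists_lift lam ψ (by
    intro u hu a
    change (regRep k r (AH.permHom k r u * a)).unop _ = (regRep k r a).unop _
    rw [map_mul, MulOpposite.unop_mul, Module.End.mul_apply, regRep_permHom_youngInd]
    simp only [youngInd_mul_right lam (inv_mem hu)])
  refine ⟨T, fun w p v => ?_⟩
  rw [hT]
  change (regRep k r (_ * _)).unop _ v = _
  rw [map_mul, MulOpposite.unop_mul, Module.End.mul_apply, regRep_permHom_youngInd, regRep_ofPoly,
    mul_comm, smul_eq_C_mul]

variable (k r) in
/-- The coordinate map of `M(λ) ⊗ AH_r` with respect to the elements `m_λ ⊗ w`. -/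
def coord : IndPermMod k r lam →ₗ[k] RegMod k r := (exists_coord lam).choose

lemma coord_perm_mul_ofPoly (w v : Equiv.Perm (Fin r)) (p : MvPolynomial (Fin r) k) :
    coord k r lam (genTmul k r lam (AH.permHom k r w * AH.ofPoly k r p)) v
      = youngInd k lam (v * w⁻¹) • p := (exists_coord lam).choose_spec w p v

lemma coord_ofPoly (v : Equiv.Perm (Fin r)) (p : MvPolynomial (Fin r) k) :
    coord k r lam (genTmul k r lam (AH.ofPoly k r p)) v = youngInd k lam v • p := by
  simpa using coord_perm_mul_ofPoly lam 1 v p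

/-- The chosen representative of the coset `S_λ w`. -/
def cosetRep (w : Equiv.Perm (Fin r)) : Equiv.Perm (Fin r) :=
  (Quotient.mk (QuotientGroup.rightRel (youngSubgroup r lam)) w).out

lemma cosetRep_mul_inv_mem (w : Equiv.Perm (Fin r)) :
    cosetRep lam w * w⁻¹ ∈ youngSubgroup r lam :=
  QuotientGroup.rightRel_apply.1
    (Setoid.symm' _ (Quotient.mk_out (s := QuotientGroup.rightRel (youngSubgroup r lam)) w))

lemma cosetRep_eq_iff {v w : Equiv.Perm (Fin r)} :
    cosetRep lam v = cosetRep lam w ↔ v * w⁻¹ ∈ youngSubgroup r lam := by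
  rw [cosetRep, cosetRep, Quotient.out_inj, eq_comm, Quotient.eq, QuotientGroup.rightRel_apply]

lemma cosetRep_idem (w : Equiv.Perm (Fin r)) :
    cosetRep lam (cosetRep lam w) = cosetRep lam w :=
  (cosetRep_eq_iff lam).2 (cosetRep_mul_inv_mem lam w)

/-- The chosen representatives of the right cosets of `S_λ`. -/
def cosetReps : Finset (Equiv.Perm (Fin r)) := Finset.univ.filter fun w => cosetRep lam w = w

lemma mem_cosetReps {w : Equiv.Perm (Fin r)} : w ∈ cosetReps lam ↔ cosetRep lam w = w := by
  simp [cosetReps]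

/-- Elements of the module are determined by their coordinates at the coset representatives. -/
lemma genTmul_sum_cosetReps (x : IndPermMod k r lam) :
    genTmul k r lam (∑ t ∈ cosetReps lam,
      AH.permHom k r t * AH.ofPoly k r (coord k r lam x t)) = x := by
  obtain ⟨a, rfl⟩ := genTmul_surjective lam x
  obtain ⟨d, hd⟩ := AH.exists_mem_filt a
  let N : AH k r →ₗ[k] IndPermMod k r lam := genTmulₗ k r lam ∘ₗ ∑ t ∈ cosetReps lam,
    LinearMap.mulLeft k (AH.permHom k r t) ∘ₗ (AH.ofPoly k r).toLinearMap ∘ₗ LinearMap.proj t ∘ₗ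
      coord k r lam ∘ₗ genTmulₗ k r lam
  have hN : ∀ a, N a = genTmul k r lam (∑ t ∈ cosetReps lam,
      AH.permHom k r t * AH.ofPoly k r (coord k r lam (genTmul k r lam a) t)) := by
    intro a
    simp [N, ← genTmulₗ_apply]
  have hle : AH.filt k r (d + 1) ≤ LinearMap.eqLocus N (genTmulₗ k r lam) := by
    refine AH.filt_le_of fun w p _ => ?_
    rw [LinearMap.mem_eqLocus, hN, Finset.sum_eq_single (cosetRep lam w)]
    · rw [coord_perm_mul_ofPoly, youngInd_of_mem lam (cosetRep_mul_inv_mem lam w), one_smul,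
        genTmulₗ_apply]
      have : AH.permHom k r (cosetRep lam w)
          = AH.permHom k r (cosetRep lam w * w⁻¹) * AH.permHom k r w := by
        rw [← map_mul, inv_mul_cancel_right]
      rw [this, mul_assoc, genTmul_perm_mul lam (cosetRep_mul_inv_mem lam w)]
    · intro t ht htw
      rw [coord_perm_mul_ofPoly, youngInd_of_not_mem, zero_smul, map_zero, mul_zero]
      intro hmem
      rw [← cosetRep_eq_iff, (mem_cosetReps lam).1 ht] at hmem
      exact htw hmem
    · intro h
      exact absurd ((mem_cosetReps lam).2 (cosetRep_idem lam w)) h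
  have := hle hd
  rwa [LinearMap.mem_eqLocus, hN, genTmulₗ_apply] at this

lemma coord_sum_cosetReps (h : Equiv.Perm (Fin r) → MvPolynomial (Fin r) k)
    {t : Equiv.Perm (Fin r)} (ht : t ∈ cosetReps lam) :
    coord k r lam (genTmul k r lam (∑ t ∈ cosetReps lam,
      AH.permHom k r t * AH.ofPoly k r (h t))) t = h t := by
  rw [← genTmulₗ_apply, map_sum, map_sum, Finset.sum_apply, Finset.sum_eq_single t]
  · rw [genTmulₗ_apply, coord_perm_mul_ofPoly, mul_inv_cancel, youngInd_of_mem lam (one_mem _),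
      one_smul]
  · intro w hw hwt
    rw [genTmulₗ_apply, coord_perm_mul_ofPoly, youngInd_of_not_mem, zero_smul]
    intro hmem
    rw [← cosetRep_eq_iff, (mem_cosetReps lam).1 ht, (mem_cosetReps lam).1 hw] at hmem
    exact hwt hmem.symm
  · exact fun h => absurd ht h

lemma coord_mem_lowDeg {d : ℕ} {a : AH k r} (ha : a ∈ AH.filt k r d) (v : Equiv.Perm (Fin r)) :
    coord k r lam (genTmul k r lam a) v ∈ lowDeg k (Fin r) d := by
  have : AH.filt k r d ≤ (lowDeg k (Fin r) d).comap
      (LinearMap.proj v ∘ₗ coord k r lam ∘ₗ genTmulₗ k r lam) := AH.filt_le_of fun w p hp => by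
    change coord k r lam (genTmul k r lam _) v ∈ lowDeg k (Fin r) d
    rw [coord_perm_mul_ofPoly]
    exact Submodule.smul_mem _ _ hp
  exact this ha

end InducedPermutationModule

section PermSum

/-! ### Translates of a monomial with trivial stabilizer -/

universe u

variable {k : Type u} [CommRing k] {r : ℕ}

variable (r) in
/-- An exponent vector with pairwise distinct entries. -/
def staircase : Fin r →₀ ℕ := Finsupp.equivFunOnFinite.symm fun i => (i : ℕ)

lemma mapDomain_staircase (w : Equiv.Perm (Fin r)) (j : Fin r) :
    Finsupp.mapDomain w (staircase r) j = (w⁻¹ j : Fin r) := by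
  have := Finsupp.mapDomain_apply w.injective (staircase r) (w⁻¹ j)
  rw [← Equiv.Perm.mul_apply, mul_inv_cancel, Equiv.Perm.one_apply] at this
  rw [this]; rfl

lemma mapDomain_staircase_injective {v w : Equiv.Perm (Fin r)}
    (h : Finsupp.mapDomain v (staircase r) = Finsupp.mapDomain w (staircase r)) : v = w := by
  refine inv_injective (Equiv.ext fun j => Fin.ext ?_)
  rw [← mapDomain_staircase, ← mapDomain_staircase, h]

/-- The monomial with exponents `0, 1, …, r - 1`.  Its translates under the symmetric group are
pairwise distinct. -/
def stairMon (k : Type u) [CommRing k] (r : ℕ) : MvPolynomial (Fin r) k := monomial (staircase r) 1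

lemma stairMon_isHomogeneous : (stairMon k r).IsHomogeneous (staircase r).degree :=
  isHomogeneous_monomial _ rfl

/-- The linear combination of the translates of `stairMon` with coefficients `c`. -/
def permSum (c : Equiv.Perm (Fin r) → k) : MvPolynomial (Fin r) k :=
  ∑ w, c w • rename ⇑w (stairMon k r)

lemma permSum_isHomogeneous (c : Equiv.Perm (Fin r) → k) :
    (permSum c).IsHomogeneous (staircase r).degree := by
  refine IsHomogeneous.sum _ _ _ fun w _ => ?_
  rw [smul_eq_C_mul]
  exact (stairMon_isHomogeneous.rename_isHomogeneous).C_mul _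

lemma coeff_permSum_mapDomain (c : Equiv.Perm (Fin r) → k) (w : Equiv.Perm (Fin r)) :
    coeff (Finsupp.mapDomain w (staircase r)) (permSum c) = c w := by
  rw [permSum, coeff_sum, Finset.sum_eq_single w]
  · simp [stairMon, rename_monomial]
  · intro v _ hv
    rw [coeff_smul, stairMon, rename_monomial, coeff_monomial, if_neg, smul_zero]
    exact fun h => hv (mapDomain_staircase_injective h)
  · simp

/-- Every coefficient of `permSum c` is `0` or one of the values of `c`, as the translates of
`stairMon` are distinct monomials. -/
lemma coeff_permSum_eq_zero_or (c : Equiv.Perm (Fin r) → k) (n : Fin r →₀ ℕ) :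
    coeff n (permSum c) = 0 ∨ ∃ w, coeff n (permSum c) = c w := by
  by_cases h : ∃ w : Equiv.Perm (Fin r), Finsupp.mapDomain w (staircase r) = n
  · obtain ⟨w, rfl⟩ := h
    exact Or.inr ⟨w, coeff_permSum_mapDomain c w⟩
  · left
    rw [permSum, coeff_sum]
    refine Finset.sum_eq_zero fun w _ => ?_
    rw [coeff_smul, stairMon, rename_monomial, coeff_monomial, if_neg fun h' => h ⟨w, h'⟩,
      smul_zero]

lemma coeff_permSum_zero_or_unit {c : Equiv.Perm (Fin r) → k} (hc : ∀ w, c w = 0 ∨ IsUnit (c w))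
    (n : Fin r →₀ ℕ) : coeff n (permSum c) = 0 ∨ IsUnit (coeff n (permSum c)) := by
  rcases coeff_permSum_eq_zero_or c n with h | ⟨w, h⟩
  · exact Or.inl h
  · rw [h]; exact hc w

lemma exists_isUnit_coeff_permSum {c : Equiv.Perm (Fin r) → k} (hu : ∃ w, IsUnit (c w)) :
    ∃ n, IsUnit (coeff n (permSum c)) := by
  obtain ⟨w, hw⟩ := hu
  exact ⟨_, by rwa [coeff_permSum_mapDomain c w]⟩

lemma rename_permSum (c : Equiv.Perm (Fin r) → k) (v : Equiv.Perm (Fin r)) :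
    rename ⇑v (permSum c) = permSum fun w => c (v⁻¹ * w) := by
  rw [permSum, map_sum, permSum]
  refine Fintype.sum_equiv (Equiv.mulLeft v) _ _ fun w => ?_
  rw [map_smul, rename_rename, Equiv.coe_mulLeft, inv_mul_cancel_left, Equiv.Perm.coe_mul]

lemma permSum_sub (c c' : Equiv.Perm (Fin r) → k) :
    permSum c - permSum c' = permSum (c - c') := by
  simp [permSum, sub_smul]

lemma sum_smul_rename_inv (c : Equiv.Perm (Fin r) → k) :
    ∑ w, c w • rename ⇑w⁻¹ (stairMon k r) = permSum fun w => c w⁻¹ :=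
  Fintype.sum_equiv (Equiv.inv _) _ _ fun w => by simp

end PermSum

section Center

/-! ### The center of the endomorphism ring -/

universe u

variable {k : Type u} [CommRing k] {r n : ℕ} (lam : Fin n → ℕ)

variable (k r) in
/-- The sum of the elements of `S_λ`. -/
def youngSum : AH k r := ∑ u, youngInd k lam u • AH.permHom k r u

lemma youngSum_mul_perm {u : Equiv.Perm (Fin r)} (hu : u ∈ youngSubgroup r lam) :
    youngSum k r lam * AH.permHom k r u = youngSum k r lam := by
  rw [youngSum, Finset.sum_mul]
  refine Fintype.sum_equiv (Equiv.mulRight u) _ _ fun w => ?_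
  rw [smul_mul_assoc, ← map_mul, Equiv.coe_mulRight, youngInd_mul_right lam hu]

lemma youngSum_mem_filt : youngSum k r lam ∈ AH.filt k r 1 :=
  sum_mem fun u _ => Submodule.smul_mem _ _ (AH.perm_mem_filt u)

/-- The leading term of `w h (∑ u)`, the sum being over `u ∈ S_λ`. -/
lemma perm_mul_ofPoly_mul_youngSum_sub_mem {e : ℕ} (w : Equiv.Perm (Fin r))
    {h : MvPolynomial (Fin r) k} (hh : h ∈ lowDeg k (Fin r) (e + 1)) :
    AH.permHom k r w * AH.ofPoly k r h * youngSum k r lam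
      - ∑ u, youngInd k lam u • (AH.permHom k r (w * u) * AH.ofPoly k r (rename ⇑u⁻¹ h))
      ∈ AH.filt k r e := by
  rw [youngSum, Finset.mul_sum, ← Finset.sum_sub_distrib]
  refine sum_mem fun u _ => ?_
  rw [mul_smul_comm, ← smul_sub]
  refine Submodule.smul_mem _ _ ?_
  have := AH.perm_mul_mem_filt w (AH.ofPoly_mul_perm_sub_mem u hh)
  rwa [mul_sub, ← mul_assoc, ← mul_assoc, ← map_mul] at this

lemma exists_mem_filt_of_coord {d : ℕ} {x : IndPermMod k r lam}
    (hx : ∀ w, coord k r lam x w ∈ lowDeg k (Fin r) d) :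
    ∃ a ∈ AH.filt k r d, genTmul k r lam a = x :=
  ⟨_, sum_mem fun t _ => AH.mul_mem_filt t (hx t), genTmul_sum_cosetReps lam x⟩

lemma genTmul_add (a b : AH k r) :
    genTmul k r lam (a + b) = genTmul k r lam a + genTmul k r lam b :=
  (genTmulₗ k r lam).map_add a b

lemma genTmul_sub (a b : AH k r) :
    genTmul k r lam (a - b) = genTmul k r lam a - genTmul k r lam b :=
  (genTmulₗ k r lam).map_sub a b

/-- The trace `∑ u g` over `u ∈ S_λ` of the staircase monomial `g`. In contrast to a general
`S_λ`-invariant it is the symbol of an endomorphism that is easily written down. -/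
def youngTrace (k : Type u) [CommRing k] (r : ℕ) {n : ℕ} (lam : Fin n → ℕ) :
    MvPolynomial (Fin r) k := permSum (youngInd k lam)

/-- Up to terms of lower degree, the endomorphism `m_λ ↦ m_λ ⊗ g (∑ u)` for the staircase monomial
`g` multiplies the generator by the trace of `g`. -/
lemma exists_genTmul_stairMon_mul_youngSum : ∃ b ∈ AH.filt k r (staircase r).degree,
    genTmul k r lam (AH.ofPoly k r (stairMon k r) * youngSum k r lam)
      = genTmul k r lam (AH.ofPoly k r (youngTrace k r lam) + b) := by
  refine ⟨_, perm_mul_ofPoly_mul_youngSum_sub_mem lam 1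
    (mem_lowDeg_of_isHomogeneous (stairMon_isHomogeneous (k := k) (r := r))), ?_⟩
  have h : genTmul k r lam (∑ u, youngInd k lam u •
        (AH.permHom k r (1 * u) * AH.ofPoly k r (rename ⇑u⁻¹ (stairMon k r))))
      = genTmul k r lam (AH.ofPoly k r (youngTrace k r lam)) := by
    have h1 : youngTrace k r lam
        = ∑ u, youngInd k lam u • rename ⇑u⁻¹ (stairMon k r) := by
      rw [sum_smul_rename_inv, youngTrace]
      congr 1
      funext w
      by_cases hw : w ∈ youngSubgroup r lam
      · rw [youngInd_of_mem lam hw, youngInd_of_mem lam (inv_mem hw)]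
      · rw [youngInd_of_not_mem lam hw,
          youngInd_of_not_mem lam (fun h => hw (by simpa using inv_mem h))]
    rw [h1, map_sum]
    simp only [← genTmulₗ_apply, map_sum, map_smul]
    refine Finset.sum_congr rfl fun u _ => ?_
    by_cases hu : u ∈ youngSubgroup r lam
    · rw [one_mul, genTmulₗ_apply, genTmul_perm_mul lam hu, genTmulₗ_apply]
    · rw [youngInd_of_not_mem lam hu, zero_smul, zero_smul]
  rw [genTmul_add, genTmul_sub, h, map_one, one_mul]
  abel

variable {lam}

/-- The action of an endomorphism on the whole module in terms of its value on the generator. -/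
lemma endo_genTmul {z : Module.End (AH k r)ᵐᵒᵖ (IndPermMod k r lam)} {a : AH k r}
    (hz : z (genTmul k r lam 1) = genTmul k r lam a) (b : AH k r) :
    z (genTmul k r lam b) = genTmul k r lam (a * b) := by
  rw [← one_mul b, ← op_smul_genTmul, map_smul, hz, op_smul_genTmul, one_mul]

/-- A central endomorphism commutes with `m_λ ↦ m_λ ⊗ y (∑ u)`. -/
lemma genTmul_comm_of_central {z : Module.End (AH k r)ᵐᵒᵖ (IndPermMod k r lam)}
    (hz : ∀ L, z * L = L * z) {a : AH k r}
    (ha : z (genTmul k r lam 1) = genTmul k r lam a) (y : AH k r) :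
    genTmul k r lam (a * (y * youngSum k r lam)) = genTmul k r lam (y * youngSum k r lam * a) := by
  obtain ⟨L, hL⟩ := exists_endo lam (y * youngSum k r lam) (fun u hu => by
    rw [mul_assoc, youngSum_mul_perm lam hu])
  have h := LinearMap.congr_fun (hz L) (genTmul k r lam 1)
  rw [Module.End.mul_apply, Module.End.mul_apply, hL, ha, hL, mul_one, endo_genTmul ha] at h
  exact h

/-- The leading term of a central endomorphism is multiplication by a polynomial. -/
lemma exists_leading_of_central {z : Module.End (AH k r)ᵐᵒᵖ (IndPermMod k r lam)}
    (hz : ∀ L, z * L = L * z) {d : ℕ}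
    (hd : ∀ w, coord k r lam (z (genTmul k r lam 1)) w ∈ lowDeg k (Fin r) (d + 1)) :
    ∃ p : MvPolynomial (Fin r) k, p.IsHomogeneous d ∧ ∃ b ∈ AH.filt k r d,
      z (genTmul k r lam 1) = genTmul k r lam (AH.ofPoly k r p + b) := by
  set F := coord k r lam (z (genTmul k r lam 1)) with hF
  set e := (staircase r).degree
  set g := youngTrace k r lam with hg_def
  have hg : g.IsHomogeneous e := permSum_isHomogeneous _
  obtain ⟨a, ha⟩ : ∃ a, a = ∑ t ∈ cosetReps lam, AH.permHom k r t * AH.ofPoly k r (F t) := ⟨_, rfl⟩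
  have hza : z (genTmul k r lam 1) = genTmul k r lam a := by
    rw [ha]; exact (genTmul_sum_cosetReps lam _).symm
  have ham : a ∈ AH.filt k r (d + 1) := by
    rw [ha]; exact sum_mem fun t _ => AH.mul_mem_filt t (hd t)
  -- `a` commutes with `g` up to terms of lower degree
  -- the endomorphism used has value `m_λ ⊗ (g + c)` on the generator, with `c` of lower degree
  obtain ⟨c, hc, hgc⟩ := exists_genTmul_stairMon_mul_youngSum (k := k) (r := r) lam
  have hcomm := genTmul_comm_of_central hz hza (AH.ofPoly k r (stairMon k r))
  rw [← endo_genTmul hza, hgc, endo_genTmul hza, ← op_smul_genTmul lam (_ * _) a, hgc,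
    op_smul_genTmul] at hcomm
  have hlow : genTmul k r lam (a * AH.ofPoly k r g - AH.ofPoly k r g * a)
      = genTmul k r lam (c * a - a * c) := by
    rw [mul_add, add_mul, genTmul_add, genTmul_add] at hcomm
    rw [genTmul_sub, genTmul_sub, sub_eq_sub_iff_add_eq_add, hcomm]
    abel
  have hlow' : c * a - a * c ∈ AH.filt k r (d + e) :=
    sub_mem (by rw [add_comm]; exact AH.mul_mem_filt_add hc ham) (AH.mul_mem_filt_add' ham hc)
  have hlead : a * AH.ofPoly k r g - AH.ofPoly k r g * a
      - ∑ t ∈ cosetReps lam, AH.permHom k r t * AH.ofPoly k r ((g - rename ⇑t⁻¹ g) * F t)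
        ∈ AH.filt k r (d + e) := by
    have hsum : a * AH.ofPoly k r g - AH.ofPoly k r g * a
        - ∑ t ∈ cosetReps lam, AH.permHom k r t * AH.ofPoly k r ((g - rename ⇑t⁻¹ g) * F t)
        = - ∑ t ∈ cosetReps lam, (AH.ofPoly k r g * AH.permHom k r t
            - AH.permHom k r t * AH.ofPoly k r (rename ⇑t⁻¹ g)) * AH.ofPoly k r (F t) := by
      rw [ha, Finset.sum_mul, Finset.mul_sum, ← Finset.sum_sub_distrib, ← Finset.sum_sub_distrib,
        ← Finset.sum_neg_distrib]
      refine Finset.sum_congr rfl fun t _ => ?_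
      have hmul : AH.ofPoly k r (F t) * AH.ofPoly k r g
          = AH.ofPoly k r g * AH.ofPoly k r (F t) := by rw [← map_mul, mul_comm, map_mul]
      rw [mul_assoc, hmul, map_mul, map_sub]
      noncomm_ring
    rw [hsum, add_comm d e]
    exact neg_mem (sum_mem fun t _ => AH.mul_ofPoly_mem_filt
      (AH.ofPoly_mul_perm_sub_mem t (mem_lowDeg_of_isHomogeneous hg)) (hd t))
  have hcoord : ∀ t ∈ cosetReps lam, (g - rename ⇑t⁻¹ g) * F t ∈ lowDeg k (Fin r) (d + e) := by
    intro t ht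
    have h1 := coord_mem_lowDeg lam hlead t
    have h2 := coord_mem_lowDeg lam hlow' t
    rw [genTmul_sub, hlow, map_sub, Pi.sub_apply] at h1
    have h3 := sub_mem h2 h1
    rwa [sub_sub_cancel, coord_sum_cosetReps lam _ ht] at h3
  have hoff : ∀ t ∈ cosetReps lam, t ∉ youngSubgroup r lam → F t ∈ lowDeg k (Fin r) d := by
    intro t ht htY
    -- for `t ∉ S_λ` the monomials of `g` and `t⁻¹ g` are disjoint, so `g - t⁻¹ g` is regular
    have hdiff : g - rename ⇑t⁻¹ g
        = permSum (youngInd k lam - fun w => youngInd k lam (t * w)) := by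
      rw [hg_def, youngTrace, rename_permSum, permSum_sub, inv_inv]
    have hval := hcoord t ht
    rw [hdiff] at hval
    refine mem_lowDeg_of_mul_mem (permSum_isHomogeneous _) (coeff_permSum_zero_or_unit ?_)
      (exists_isUnit_coeff_permSum ⟨1, ?_⟩) (hd t) hval
    · intro w
      simp only [Pi.sub_apply]
      by_cases h1 : w ∈ youngSubgroup r lam <;> by_cases h2 : t * w ∈ youngSubgroup r lam
      · simp [youngInd_of_mem, h1, h2]
      · simp [youngInd_of_mem, youngInd_of_not_mem, h1, h2]
      · simp [youngInd_of_mem, youngInd_of_not_mem, h1, h2]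
      · simp [youngInd_of_not_mem, h1, h2]
    · simp [youngInd_of_mem lam (one_mem _), youngInd_of_not_mem lam htY]
  -- only the trivial coset contributes to the leading term
  have ht₀ : cosetRep lam (1 : Equiv.Perm (Fin r)) ∈ cosetReps lam :=
    (mem_cosetReps lam).2 (cosetRep_idem lam 1)
  have ht₀Y : cosetRep lam (1 : Equiv.Perm (Fin r)) ∈ youngSubgroup r lam := by
    simpa using cosetRep_mul_inv_mem lam (1 : Equiv.Perm (Fin r))
  set t₀ := cosetRep lam (1 : Equiv.Perm (Fin r)) with ht₀_def
  refine ⟨homogeneousComponent d (F t₀), homogeneousComponent_isHomogeneous _ _,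
    AH.ofPoly k r (F t₀ - homogeneousComponent d (F t₀))
      + ∑ t ∈ (cosetReps lam).erase t₀, AH.permHom k r t * AH.ofPoly k r (F t), ?_, ?_⟩
  · refine add_mem (AH.ofPoly_mem_filt (sub_homogeneousComponent_mem_lowDeg (hd _)))
      (sum_mem fun t ht => AH.mul_mem_filt t (hoff t (Finset.mem_of_mem_erase ht) fun htY => ?_))
    refine Finset.ne_of_mem_erase ht ?_
    rw [← (mem_cosetReps lam).1 (Finset.mem_of_mem_erase ht), ht₀_def, cosetRep_eq_iff]
    simpa using htY
  · rw [hza, ha, ← Finset.add_sum_erase _ _ ht₀, genTmul_add, genTmul_perm_mul lam ht₀Y,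
      ← add_assoc, map_sub, add_sub_cancel, genTmul_add]

/-- The leading polynomial of a central endomorphism is symmetric. -/
lemma leading_isSymmetric {z : Module.End (AH k r)ᵐᵒᵖ (IndPermMod k r lam)}
    (hz : ∀ L, z * L = L * z) {d : ℕ} {p : MvPolynomial (Fin r) k} (hp : p.IsHomogeneous d)
    {b : AH k r} (hb : b ∈ AH.filt k r d)
    (hzp : z (genTmul k r lam 1) = genTmul k r lam (AH.ofPoly k r p + b)) : p.IsSymmetric := by
  have hpl := mem_lowDeg_of_isHomogeneous hp
  -- invariance under the Young subgroup
  have hY : ∀ u ∈ youngSubgroup r lam, rename ⇑u⁻¹ p = p := by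
    intro u hu
    have h1 : genTmul k r lam ((AH.ofPoly k r p + b) * AH.permHom k r u)
        = genTmul k r lam (AH.ofPoly k r p + b) := by
      rw [← endo_genTmul hzp, ← hzp, ← mul_one (AH.permHom k r u), genTmul_perm_mul lam hu]
    have hm := sub_mem (AH.ofPoly_mul_perm_sub_mem u hpl) hb
    have hbu : b * AH.permHom k r u ∈ AH.filt k r d :=
      AH.mul_mem_filt_add (e := 0) hb (AH.perm_mem_filt u)
    have hm' := coord_mem_lowDeg lam (add_mem hm hbu) 1
    have h2 : genTmul k r lam (AH.ofPoly k r p * AH.permHom k r u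
          - AH.permHom k r u * AH.ofPoly k r (rename ⇑u⁻¹ p) - b + b * AH.permHom k r u)
        = genTmul k r lam (AH.ofPoly k r (p - rename ⇑u⁻¹ p)) := by
      rw [add_mul, genTmul_add, genTmul_add] at h1
      rw [genTmul_add, genTmul_sub, genTmul_sub, genTmul_perm_mul lam hu, map_sub, genTmul_sub,
        ← sub_eq_zero]
      rw [← sub_eq_zero] at h1
      rw [← h1]
      abel
    rw [h2, coord_ofPoly, youngInd_of_mem lam (one_mem _), one_smul] at hm'
    exact (sub_eq_zero.1 (eq_zero_of_isHomogeneous_of_mem_lowDeg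
      (hp.sub hp.rename_isHomogeneous) hm')).symm
  -- invariance under an arbitrary permutation
  suffices h : ∀ w : Equiv.Perm (Fin r), rename ⇑w⁻¹ p = p by
    intro w
    simpa using h w⁻¹
  intro w
  set e := (staircase r).degree
  set g := stairMon k r
  have hg : g.IsHomogeneous e := stairMon_isHomogeneous
  have hgl := mem_lowDeg_of_isHomogeneous hg
  have hx := youngSum_mem_filt (k := k) (r := r) lam
  set x := youngSum k r lam
  have hcomm := genTmul_comm_of_central hz hzp (AH.permHom k r w * AH.ofPoly k r g)
  let c : Equiv.Perm (Fin r) → k := fun u => youngInd k lam u * youngInd k lam (w * u⁻¹ * w⁻¹)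
  let G := ∑ u, c u • rename ⇑u⁻¹ g
  have hG : G = permSum fun u => c u⁻¹ := sum_smul_rename_inv c
  -- the coordinate at `w` of `(p + b) w g x`
  have hleft : coord k r lam (genTmul k r lam ((AH.ofPoly k r p + b)
      * (AH.permHom k r w * AH.ofPoly k r g * x))) w - G * rename ⇑w⁻¹ p
      ∈ lowDeg k (Fin r) (d + e) := by
    -- moving `w` to the left turns `p` into `w⁻¹ p`; the remainders have degree below `d + e`
    have hh : rename ⇑w⁻¹ p * g ∈ lowDeg k (Fin r) (d + e + 1) :=
      mem_lowDeg_of_isHomogeneous (hp.rename_isHomogeneous.mul hg)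
    have h1 := perm_mul_ofPoly_mul_youngSum_sub_mem lam w hh
    have h2 := AH.mul_mem_filt_add (e := 0)
      (AH.mul_ofPoly_mem_filt (AH.ofPoly_mul_perm_sub_mem w hpl) hgl) hx
    have h3 := AH.mul_mem_filt_add (e := 0) (AH.mul_ofPoly_mem_filt
      (AH.mul_mem_filt_add (e := 0) hb (AH.perm_mem_filt w)) hgl) hx
    have h4 := coord_mem_lowDeg lam (add_mem (add_mem h1 h2) h3) w
    have heq : ∀ S : AH k r, AH.permHom k r w * AH.ofPoly k r (rename ⇑w⁻¹ p * g) * x - S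
        + (AH.ofPoly k r p * AH.permHom k r w
            - AH.permHom k r w * AH.ofPoly k r (rename ⇑w⁻¹ p)) * AH.ofPoly k r g * x
        + b * AH.permHom k r w * AH.ofPoly k r g * x
        = (AH.ofPoly k r p + b) * (AH.permHom k r w * AH.ofPoly k r g * x) - S := by
      intro S
      rw [map_mul]
      noncomm_ring
    rw [heq, genTmul_sub, map_sub, Pi.sub_apply] at h4
    convert h4 using 2
    rw [← genTmulₗ_apply, map_sum, map_sum, Finset.sum_apply, Finset.sum_mul]
    refine Finset.sum_congr rfl fun u _ => ?_
    rw [map_smul, map_smul, Pi.smul_apply, genTmulₗ_apply, coord_perm_mul_ofPoly, mul_inv_rev,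
      ← mul_assoc, smul_smul, map_mul, smul_mul_assoc]
    by_cases hw : w * u⁻¹ * w⁻¹ ∈ youngSubgroup r lam
    · -- on the stabilizer of the coset `S_λ w`, `u⁻¹` fixes `w⁻¹ p`
      have h5 := hY _ (inv_mem hw)
      have h6 : rename ⇑u⁻¹ (rename ⇑w⁻¹ p) = rename ⇑w⁻¹ p := by
        conv_rhs => rw [← h5]
        rw [rename_rename, rename_rename, ← Equiv.Perm.coe_mul, ← Equiv.Perm.coe_mul]
        congr 3
        group
      rw [h6, mul_comm (rename ⇑w⁻¹ p)]
    · simp only [c, youngInd_of_not_mem lam hw, mul_zero, zero_smul]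
  -- the coordinate at `w` of `w g x (p + b)`
  have hright : coord k r lam (genTmul k r lam (AH.permHom k r w * AH.ofPoly k r g * x
      * (AH.ofPoly k r p + b))) w - G * p ∈ lowDeg k (Fin r) (d + e) := by
    have h1 := AH.mul_ofPoly_mem_filt (perm_mul_ofPoly_mul_youngSum_sub_mem lam w hgl) hpl
    have h2 : AH.permHom k r w * AH.ofPoly k r g * x * b ∈ AH.filt k r (e + d) :=
      AH.mul_mem_filt_add' (AH.mul_mem_filt_add (e := 0) (AH.mul_mem_filt w hgl) hx) hb
    have h4 := coord_mem_lowDeg lam (add_mem h1 h2) w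
    rw [add_comm d e]
    have heq : ∀ S : AH k r, (AH.permHom k r w * AH.ofPoly k r g * x - S) * AH.ofPoly k r p
        + AH.permHom k r w * AH.ofPoly k r g * x * b
        = AH.permHom k r w * AH.ofPoly k r g * x * (AH.ofPoly k r p + b)
          - S * AH.ofPoly k r p := by
      intro S
      noncomm_ring
    rw [heq, genTmul_sub, map_sub, Pi.sub_apply, Finset.sum_mul] at h4
    convert h4 using 2
    rw [← genTmulₗ_apply, map_sum, map_sum, Finset.sum_apply, Finset.sum_mul]
    refine Finset.sum_congr rfl fun u _ => ?_
    rw [smul_mul_assoc, smul_mul_assoc, map_smul, map_smul, Pi.smul_apply, genTmulₗ_apply,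
      mul_assoc, ← map_mul, coord_perm_mul_ofPoly, mul_inv_rev, ← mul_assoc, smul_smul]
  -- comparing leading terms, `G (w⁻¹ p - p) = 0`, and `G` is a nonzero divisor
  rw [hcomm] at hleft
  have hdiff := sub_mem hright hleft
  rw [sub_sub_sub_cancel_left, ← mul_sub] at hdiff
  have hGh : G.IsHomogeneous e := by rw [hG]; exact permSum_isHomogeneous _
  have hzero := eq_zero_of_isHomogeneous_of_mem_lowDeg
    (hGh.mul (hp.rename_isHomogeneous.sub hp)) (by rwa [add_comm] at hdiff)
  rw [hG] at hzero
  refine sub_eq_zero.1 (mul_eq_zero_of_coeff_zero_or_unit (coeff_permSum_zero_or_unit ?_)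
    (exists_isUnit_coeff_permSum ⟨1, ?_⟩) hzero)
  · intro u
    simp only [c]
    by_cases h1 : u⁻¹ ∈ youngSubgroup r lam
    · by_cases h2 : w * u⁻¹⁻¹ * w⁻¹ ∈ youngSubgroup r lam
      · rw [youngInd_of_mem lam h1, youngInd_of_mem lam h2]; simp
      · rw [youngInd_of_not_mem lam h2]; simp
    · simp [youngInd_of_not_mem lam h1]
  · simp [c, youngInd_of_mem lam (one_mem _)]

/-- Multiplication by a symmetric polynomial, which is central in `AH_r`, is an endomorphism. -/
lemma exists_mul_ofPoly {f : MvPolynomial (Fin r) k} (hf : f.IsSymmetric) :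
    ∃ L : Module.End (AH k r)ᵐᵒᵖ (IndPermMod k r lam),
      ∀ a, L (genTmul k r lam a) = genTmul k r lam (AH.ofPoly k r f * a) :=
  exists_endo lam _ fun u hu => by
    rw [AH.ofPoly_commute_of_isSymmetric k hf, genTmul_perm_mul lam hu]

lemma mul_ofPoly_comm {f : MvPolynomial (Fin r) k} (hf : f.IsSymmetric)
    {L : Module.End (AH k r)ᵐᵒᵖ (IndPermMod k r lam)}
    (hL : L (genTmul k r lam 1) = genTmul k r lam (AH.ofPoly k r f))
    (L' : Module.End (AH k r)ᵐᵒᵖ (IndPermMod k r lam)) : L * L' = L' * L := by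
  refine endo_ext lam ?_
  obtain ⟨a, ha⟩ := genTmul_surjective lam (L' (genTmul k r lam 1))
  rw [Module.End.mul_apply, Module.End.mul_apply, hL, ← ha, endo_genTmul hL,
    endo_genTmul ha.symm, AH.ofPoly_commute_of_isSymmetric k hf]

/-- Central endomorphisms are multiplications by symmetric polynomials. -/
theorem exists_symmetric_of_central {z : Module.End (AH k r)ᵐᵒᵖ (IndPermMod k r lam)}
    (hz : ∀ L, z * L = L * z) :
    ∃ f : MvPolynomial (Fin r) k, f.IsSymmetric ∧
      z (genTmul k r lam 1) = genTmul k r lam (AH.ofPoly k r f) := by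
  suffices h : ∀ (d : ℕ) (z : Module.End (AH k r)ᵐᵒᵖ (IndPermMod k r lam)),
      (∀ L, z * L = L * z) →
      (∀ w, coord k r lam (z (genTmul k r lam 1)) w ∈ lowDeg k (Fin r) d) →
      ∃ f : MvPolynomial (Fin r) k, f.IsSymmetric ∧
        z (genTmul k r lam 1) = genTmul k r lam (AH.ofPoly k r f) by
    obtain ⟨a, ha⟩ := genTmul_surjective lam (z (genTmul k r lam 1))
    obtain ⟨d, hd⟩ := AH.exists_mem_filt a
    exact h (d + 1) z hz fun w => by rw [← ha]; exact coord_mem_lowDeg lam hd w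
  intro d
  induction d with
  | zero =>
    intro z _ hd
    refine ⟨0, IsSymmetric.zero, ?_⟩
    obtain ⟨a, ha, hza⟩ := exists_mem_filt_of_coord lam hd
    rw [← hza, AH.filt_zero ha, map_zero]
  | succ d ih =>
    intro z hz hd
    obtain ⟨p, hp, b, hb, hzp⟩ := exists_leading_of_central hz hd
    have hsym := leading_isSymmetric hz hp hb hzp
    obtain ⟨L, hL⟩ := exists_mul_ofPoly (lam := lam) hsym
    have hL1 : L (genTmul k r lam 1) = genTmul k r lam (AH.ofPoly k r p) := by rw [hL, mul_one]
    have hzL : (z - L) (genTmul k r lam 1) = genTmul k r lam b := by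
      rw [LinearMap.sub_apply, hzp, hL1, genTmul_add, add_sub_cancel_left]
    obtain ⟨f, hf, hfz⟩ := ih (z - L)
      (fun L' => by rw [sub_mul, mul_sub, hz, mul_ofPoly_comm hsym hL1])
      (fun w => by rw [hzL]; exact coord_mem_lowDeg lam hb w)
    refine ⟨f + p, hf.add hsym, ?_⟩
    rw [LinearMap.sub_apply, sub_eq_iff_eq_add, hL1] at hfz
    rw [hfz, map_add, genTmul_add]

lemma genTmul_ofPoly_injective {f g : MvPolynomial (Fin r) k}
    (h : genTmul k r lam (AH.ofPoly k r f) = genTmul k r lam (AH.ofPoly k r g)) : f = g := by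
  have h1 := congrFun (congrArg (coord k r lam) h) 1
  rwa [coord_ofPoly, coord_ofPoly, youngInd_of_mem lam (one_mem _), one_smul, one_smul] at h1

end Center

section EndomorphismAlgebra

/-! ### Endomorphisms in the affine Schur category -/

universe u

variable {k : Type u} [CommRing k] {r : ℕ} {X : ASchur k}

namespace ASchur

/-- The endomorphism of `λ` with a given underlying module homomorphism. -/
def ofEndo (hr : X.size = r) (L : Module.End (AH k r)ᵐᵒᵖ (IndPermMod k r X.parts)) :
    CategoryTheory.End X :=
  Hom.mk fun r' h _ => by subst hr; subst h; exact L

lemma app_ofEndo (hr : X.size = r) (L : Module.End (AH k r)ᵐᵒᵖ (IndPermMod k r X.parts)) :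
    app (ofEndo hr L) r hr hr = L := by
  subst hr; rfl

lemma app_injective (hr : X.size = r) {φ ψ : CategoryTheory.End X}
    (h : app φ r hr hr = app ψ r hr hr) : φ = ψ := by
  refine hom_ext fun r' h₁ h₂ => ?_
  subst hr; subst h₁; exact h

lemma app_mul (hr : X.size = r) (φ ψ : CategoryTheory.End X) :
    app (φ * ψ) r hr hr
      = (show Module.End (AH k r)ᵐᵒᵖ (IndPermMod k r X.parts) from app φ r hr hr)
        * (show Module.End (AH k r)ᵐᵒᵖ (IndPermMod k r X.parts) from app ψ r hr hr) :=
  app_comp ψ φ r hr hr hr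

end ASchur

lemma isPinned_ext {hr : X.size = r} {f : MvPolynomial (Fin r) k} {φ ψ : CategoryTheory.End X}
    (hφ : IsPinned k hr f φ) (hψ : IsPinned k hr f ψ) : φ = ψ :=
  ASchur.app_injective hr (endo_ext _ (Eq.trans hφ hψ.symm))

lemma exists_isPinned (hr : X.size = r) {f : MvPolynomial (Fin r) k} (hf : f.IsSymmetric) :
    ∃ φ : CategoryTheory.End X, IsPinned k hr f φ := by
  obtain ⟨L, hL⟩ := exists_mul_ofPoly (lam := X.parts) hf
  refine ⟨ASchur.ofEndo hr L, ?_⟩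
  rw [IsPinned, ASchur.app_ofEndo, hL, mul_one]

lemma IsPinned.mul {hr : X.size = r} {f g : MvPolynomial (Fin r) k} {φ ψ : CategoryTheory.End X}
    (hφ : IsPinned k hr f φ) (hψ : IsPinned k hr g ψ) : IsPinned k hr (f * g) (φ * ψ) := by
  rw [IsPinned, ASchur.app_mul, Module.End.mul_apply, hψ, map_mul]
  exact endo_genTmul hφ _

lemma IsPinned.add {hr : X.size = r} {f g : MvPolynomial (Fin r) k} {φ ψ : CategoryTheory.End X}
    (hφ : IsPinned k hr f φ) (hψ : IsPinned k hr g ψ) : IsPinned k hr (f + g) (φ + ψ) := by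
  unfold IsPinned at *
  rw [map_add, genTmul_add, ← hφ, ← hψ]
  rfl

lemma IsPinned.algebraMap (hr : X.size = r) (c : k) :
    IsPinned k hr (algebraMap k (MvPolynomial (Fin r) k) c)
      (algebraMap k (CategoryTheory.End X) c) := by
  unfold IsPinned
  rw [AlgHom.commutes, Algebra.algebraMap_eq_smul_one, Algebra.algebraMap_eq_smul_one,
    ← genTmulₗ_apply, ← genTmulₗ_apply, map_smul]
  rfl

lemma IsPinned.mem_center {hr : X.size = r} {f : MvPolynomial (Fin r) k}
    {φ : CategoryTheory.End X} (hf : f.IsSymmetric) (hφ : IsPinned k hr f φ) :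
    φ ∈ Subalgebra.center k (CategoryTheory.End X) := by
  rw [Subalgebra.mem_center_iff]
  intro ψ
  refine ASchur.app_injective hr ?_
  rw [ASchur.app_mul, ASchur.app_mul]
  exact (mul_ofPoly_comm hf hφ _).symm

lemma exists_isPinned_of_mem_center (hr : X.size = r) {φ : CategoryTheory.End X}
    (hφ : φ ∈ Subalgebra.center k (CategoryTheory.End X)) :
    ∃ f : MvPolynomial (Fin r) k, f.IsSymmetric ∧ IsPinned k hr f φ := by
  rw [Subalgebra.mem_center_iff] at hφ
  refine exists_symmetric_of_central fun L => ?_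
  have h := congrArg (fun χ => ASchur.app χ r hr hr) (hφ (ASchur.ofEndo hr L))
  simp only [ASchur.app_mul, ASchur.app_ofEndo] at h
  exact h.symm

lemma exists_centerEquiv (hr : X.size = r) :
    ∃ e : symmetricSubalgebra (Fin r) k ≃ₐ[k] Subalgebra.center k (CategoryTheory.End X),
      ∀ f : symmetricSubalgebra (Fin r) k,
        IsPinned k hr (f : MvPolynomial (Fin r) k) (e f : CategoryTheory.End X) := by
  choose φ hφ using fun f : symmetricSubalgebra (Fin r) k => exists_isPinned (X := X) hr f.2
  let Φ : symmetricSubalgebra (Fin r) k →ₐ[k] Subalgebra.center k (CategoryTheory.End X) :=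
    { toFun := fun f => ⟨φ f, (hφ f).mem_center f.2⟩
      map_one' := Subtype.ext (isPinned_ext (hφ 1) (by
        simpa using IsPinned.algebraMap (X := X) hr (1 : k)))
      map_mul' := fun f g => Subtype.ext (isPinned_ext (hφ _) ((hφ f).mul (hφ g)))
      map_zero' := Subtype.ext (isPinned_ext (hφ 0) (by
        simpa using IsPinned.algebraMap (X := X) hr (0 : k)))
      map_add' := fun f g => Subtype.ext (isPinned_ext (hφ _) ((hφ f).add (hφ g)))
      commutes' := fun c => Subtype.ext (isPinned_ext (hφ _) (IsPinned.algebraMap hr c)) }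
  have hΦ : ∀ f, (Φ f : CategoryTheory.End X) = φ f := fun _ => rfl
  refine ⟨AlgEquiv.ofBijective Φ ⟨fun f g hfg => Subtype.ext ?_, fun z => ?_⟩, hφ⟩
  · have h1 : φ f = φ g := congrArg Subtype.val hfg
    have h2 := hφ f
    rw [h1] at h2
    exact genTmul_ofPoly_injective (Eq.trans h2.symm (hφ g))
  · obtain ⟨f, hf, hfz⟩ := exists_isPinned_of_mem_center hr z.2
    exact ⟨⟨f, hf⟩, Subtype.ext (isPinned_ext (hφ ⟨f, hf⟩) hfz)⟩

end EndomorphismAlgebra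

end AffSchur

end

theorem lemma6p3 {k : Type*} [CommRing k] (n r : ℕ) (lam : Fin n → ℕ)
    (hr : ∑ i, lam i = r) :
    (∀ f ∈ MvPolynomial.symmetricSubalgebra (Fin r) k,
      ∃! φ : CategoryTheory.End (AffSchur.ASchur.mk n lam : AffSchur.ASchur k),
        AffSchur.IsPinned k (X := ⟨n, lam⟩) hr f φ) ∧
    ∃ e : MvPolynomial.symmetricSubalgebra (Fin r) k ≃ₐ[k]
        Subalgebra.center k
          (CategoryTheory.End (AffSchur.ASchur.mk n lam : AffSchur.ASchur k)),
      ∀ f : MvPolynomial.symmetricSubalgebra (Fin r) k,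
        AffSchur.IsPinned k (X := ⟨n, lam⟩) hr (f : MvPolynomial (Fin r) k)
          (e f : CategoryTheory.End (AffSchur.ASchur.mk n lam : AffSchur.ASchur k)) := by
  refine ⟨fun f hf => ?_, AffSchur.exists_centerEquiv (X := ⟨n, lam⟩) hr⟩
  obtain ⟨φ, hφ⟩ := AffSchur.exists_isPinned (X := ⟨n, lam⟩) hr hf
  exact ⟨φ, hφ, fun ψ hψ => AffSchur.isPinned_ext hψ hφ⟩
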